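/- Let $k$ be a field, let $S=k[x_1,\dots,x_n]$ with its fine $\mathbb{Z}^n$-grading, and let $\mathfrak m=(x_1,\dots,x_n)$. A *multigraded DGA over $S$* is an associative unital $S$-algebra $A=\bigoplus_{i\ge 0,\,\mathbf a\in\mathbb{Z}^n}A_{i,\mathbf a}$ with $A_{i,\mathbf a}A_{j,\mathbf b}\subseteq A_{i+j,\mathbf a+\mathbf b}$ and with the image of $S_{\mathbf a}$ contained in $A_{0,\mathbf a}$, together with an $S$-linear differential $\partial$, $\partial^2=0$, $\partial(A_{i+1,\mathbf a})\subseteq A_{i,\mathbf a}$, $\partial(A_{0,\mathbf a})=0$, such that $\partial(ab)=\partial(a)b+(-1)^{|a|}a\,\partial(b)$ and $ab=(-1)^{|a||b|}ba$ for homogeneous $a,b$ of homological degrees $|a|,|b|$. A *DG-ideal* is a homogeneous two-sided ideal $J$ with $\partial(J)\subseteq J$. Let $I\subseteq S$ be an ideal generated by squarefree monomials, let $G(I)$ be the set of its minimal monomial generators, and fix any total order $\prec$ on $G(I)$. For $W\subseteq G(I)$ put $m_W=\operatorname{lcm}(m: m\in W)$. The *Taylor resolution* $\mathbb{T}$ of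 $S/I$ is the free $S$-module with basis $\{\mathbf g_W: W\subseteq G(I)\}$, where $\mathbf g_W$ has homological degree $\#W$ and multidegree $\deg m_W$, with differential $$\partial\mathbf g_W=\sum_{m\in W}(-1)^{\#\{m'\in W:\,m'\prec m\}}\frac{m_W}{m_{W\setminus\{m\}}}\,\mathbf g_{W\setminus\{m\}}$$ and with the multiplication given by $\mathbf g_W*\mathbf g_V=(-1)^{\#\{(m,m')\in W\times V:\,m'\prec m\}}\frac{m_Wm_V}{m_{W\cup V}}\,\mathbf g_{W\cup V}$ if $W\cap V=\emptyset$ and $\mathbf g_W*\mathbf g_V=0$ otherwise. **Theorem 3.6.** Let $\mathbb{F}$ be a multigraded DGA over $S$ whose underlying complex is a minimal multigraded free resolution of $S/I$ (so $\mathbb{F}$ has a homogeneous $S$-basis, $H_0(\mathbb{F})\cong S/I$ as multigraded modules, $H_i(\mathbb{F})=0$ for $i\geq 1$, and $\partial\mathbb{F}\subseteq\mathfrak m\mathbb{F}$). Then there is a DG-ideal $J\subseteq\mathbb{T}$ such that $\mathbb{F}\cong\mathbb{T}/J$ as multigraded DGAs over $S$, that is, by an isomorphism of $S$-algebras that preserves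 homological degrees and multidegrees and commutes with the differentials. -/

import Mathlib

noncomputable section

namespace TaylorDGA

universe u v w

/-! ### The multigraded polynomial ring and squarefree monomial ideals -/

section Polynomial

variable {k : Type u} [Field k] {n : ℕ}

/-- The component of multidegree `a : ℤⁿ` in the fine `ℤⁿ`-grading of `k[x₁, …, xₙ]`. -/
def polyGrading (a : Fin n → ℤ) : AddSubgroup (MvPolynomial (Fin n) k) where
  carrier := {p | ∀ e : Fin n →₀ ℕ, p.coeff e ≠ 0 → ∀ j, (e j : ℤ) = a j}
  zero_mem' := by intro e he; simp at he
  add_mem' := by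
    intro p q hp hq e he
    by_cases h : p.coeff e = 0
    · exact hq e (by simpa [h] using he)
    · exact hp e h
  neg_mem' := by
    intro p hp e he
    exact hp e (by simpa using he)

/-- The ideal `I` can be generated by squarefree monomials. -/
def IsSquarefreeMonomialIdeal (I : Ideal (MvPolynomial (Fin n) k)) : Prop :=
  ∃ M : Set (Fin n →₀ ℕ), (∀ e ∈ M, ∀ j, e j ≤ 1) ∧
    I = Ideal.span ((fun e => MvPolynomial.monomial e (1 : k)) '' M)

/-- The set `G(I)` of minimal monomial generators of a monomial ideal `I`, i.e. of the monomials
in `I` that are minimal under divisibility; a monomial is represented by its exponent vector.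
This is a type of its own (not a reducible subtype), so that it carries no order by default. -/
def MinGen (I : Ideal (MvPolynomial (Fin n) k)) : Type :=
  {e : Fin n →₀ ℕ // Minimal (fun e' => MvPolynomial.monomial e' (1 : k) ∈ I) e}

/-- The exponent vector of a minimal generator. -/
def MinGen.exponent {I : Ideal (MvPolynomial (Fin n) k)} (m : MinGen I) : Fin n →₀ ℕ :=
  m.1

/-- The exponent vector of `m_W`, the least common multiple of the generators in `W`. -/
def lcmExp {I : Ideal (MvPolynomial (Fin n) k)} (W : Finset (MinGen I)) : Fin n →₀ ℕ :=
  W.sup MinGen.exponent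

theorem lcmExp_empty {I : Ideal (MvPolynomial (Fin n) k)} :
    lcmExp (∅ : Finset (MinGen I)) = 0 := rfl

end Polynomial

/-! ### Multigraded DGAs over the polynomial ring

A multigraded DGA over `S = k[x₁, …, xₙ]` is given by an associative unital `S`-algebra `A`, its
components `𝓐 (i, a)` of homological degree `i` and multidegree `a`, and an `S`-linear
differential `d`. -/

section DGA

variable {k : Type u} [Field k] {n : ℕ}
variable {A : Type v} [Ring A] [Algebra (MvPolynomial (Fin n) k) A]
variable {B : Type w} [Ring B] [Algebra (MvPolynomial (Fin n) k) B]

/-- The axioms of a multigraded (graded-commutative) DGA over `k[x₁, …, xₙ]`.  That the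
underlying module is the direct sum of the components `𝓐 (i, a)`, that products of homogeneous
elements are homogeneous of the expected bidegree, and that `1` lies in bidegree `(0, 0)`,
is the content of `GradedRing 𝓐`. -/
structure IsMultigradedDGA (𝓐 : ℕ × (Fin n → ℤ) → AddSubgroup A) [GradedRing 𝓐]
    (d : A →ₗ[MvPolynomial (Fin n) k] A) : Prop where
  /-- The action of `S` is compatible with the multigrading. -/
  algebraMap_mem : ∀ (a : Fin n → ℤ) (p : MvPolynomial (Fin n) k), p ∈ polyGrading a →
    algebraMap (MvPolynomial (Fin n) k) A p ∈ 𝓐 (0, a)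
  /-- The differential lowers the homological degree by one and preserves the multidegree. -/
  d_mem : ∀ (i : ℕ) (a : Fin n → ℤ) (x : A), x ∈ 𝓐 (i + 1, a) → d x ∈ 𝓐 (i, a)
  /-- The differential vanishes in homological degree zero. -/
  d_zero : ∀ (a : Fin n → ℤ) (x : A), x ∈ 𝓐 (0, a) → d x = 0
  d_d : ∀ x : A, d (d x) = 0
  /-- The Leibniz rule. -/
  leibniz : ∀ (i : ℕ) (a : Fin n → ℤ) (x y : A), x ∈ 𝓐 (i, a) →
    d (x * y) = d x * y + (-1) ^ i * (x * d y)
  /-- Graded commutativity. -/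
  graded_comm : ∀ (i j : ℕ) (a b : Fin n → ℤ) (x y : A), x ∈ 𝓐 (i, a) → y ∈ 𝓐 (j, b) →
    x * y = (-1) ^ (i * j) * (y * x)

/-- The part of homological degree `i`, as a module over the polynomial ring. -/
def homologicalPart (𝓐 : ℕ × (Fin n → ℤ) → AddSubgroup A) (i : ℕ) :
    Submodule (MvPolynomial (Fin n) k) A :=
  Submodule.span (MvPolynomial (Fin n) k) {x | ∃ a : Fin n → ℤ, x ∈ 𝓐 (i, a)}

/-- The complex underlying `(A, 𝓐, d)` is a minimal multigraded free resolution of `S/I`. -/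
structure IsMinimalFreeResolution (I : Ideal (MvPolynomial (Fin n) k))
    (𝓐 : ℕ × (Fin n → ℤ) → AddSubgroup A) (d : A →ₗ[MvPolynomial (Fin n) k] A) : Prop where
  /-- The underlying module has a basis of homogeneous elements. -/
  free : ∃ X : Set A, (∀ x ∈ X, ∃ p, x ∈ 𝓐 p) ∧
    LinearIndependent (MvPolynomial (Fin n) k) (fun x : X => (x : A)) ∧
    Submodule.span (MvPolynomial (Fin n) k) X = ⊤
  /-- Exactness in positive homological degrees. -/
  exact : ∀ (i : ℕ), ∀ x ∈ homologicalPart (k := k) 𝓐 (i + 1), d x = 0 →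
    ∃ y ∈ homologicalPart (k := k) 𝓐 (i + 2), d y = x
  /-- There is a multigraded augmentation map onto `S/I` whose kernel is the image of the
  differential. -/
  augmentation : ∃ ε : homologicalPart (k := k) 𝓐 0 →ₗ[MvPolynomial (Fin n) k]
      (MvPolynomial (Fin n) k ⧸ I),
    Function.Surjective ε ∧
    (∀ x, ε x = 0 ↔ ∃ y ∈ homologicalPart (k := k) 𝓐 1, d y = x) ∧
    (∀ (a : Fin n → ℤ) (x : homologicalPart (k := k) 𝓐 0), (x : A) ∈ 𝓐 (0, a) →
      ∃ p : MvPolynomial (Fin n) k, p ∈ polyGrading a ∧ ε x = Ideal.Quotient.mk I p)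
  /-- Minimality: the image of `d` is contained in `𝔪 A`, where `𝔪 = (x₁, …, xₙ)`. -/
  minimal : ∀ x : A, d x ∈ Ideal.span (Set.range (MvPolynomial.X : Fin n → MvPolynomial (Fin n) k)) •
    (⊤ : Submodule (MvPolynomial (Fin n) k) A)

/-- A DG-ideal: a homogeneous two-sided ideal which is closed under the differential. -/
structure DGIdeal (𝓐 : ℕ × (Fin n → ℤ) → AddSubgroup A)
    (d : A →ₗ[MvPolynomial (Fin n) k] A) where
  ideal : Ideal A
  isTwoSided : ideal.IsTwoSided
  homogeneous : ideal ≤ Ideal.span {x | x ∈ ideal ∧ ∃ p, x ∈ 𝓐 p}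
  d_mem : ∀ x ∈ ideal, d x ∈ ideal

attribute [instance] DGIdeal.isTwoSided

/-- The quotient algebra `A/J` of a DGA by a DG-ideal. -/
abbrev DGIdeal.Quot {𝓐 : ℕ × (Fin n → ℤ) → AddSubgroup A}
    {d : A →ₗ[MvPolynomial (Fin n) k] A} (J : DGIdeal 𝓐 d) : Type v :=
  A ⧸ J.ideal

/-- The multigrading of `A/J`: the images of the components of `A`. -/
def DGIdeal.quotGrading {𝓐 : ℕ × (Fin n → ℤ) → AddSubgroup A}
    {d : A →ₗ[MvPolynomial (Fin n) k] A} (J : DGIdeal 𝓐 d) (p : ℕ × (Fin n → ℤ)) :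
    AddSubgroup J.Quot :=
  (𝓐 p).map (Ideal.Quotient.mk J.ideal).toAddMonoidHom

/-- The differential of `A/J`, which maps the class of `x` to the class of `d x`. -/
def DGIdeal.quotD {𝓐 : ℕ × (Fin n → ℤ) → AddSubgroup A}
    {d : A →ₗ[MvPolynomial (Fin n) k] A} (J : DGIdeal 𝓐 d) :
    J.Quot →ₗ[MvPolynomial (Fin n) k] J.Quot :=
  (J.ideal.restrictScalars (MvPolynomial (Fin n) k)).mapQ
    (J.ideal.restrictScalars (MvPolynomial (Fin n) k)) d J.d_mem

theorem DGIdeal.quotD_mk {𝓐 : ℕ × (Fin n → ℤ) → AddSubgroup A}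
    {d : A →ₗ[MvPolynomial (Fin n) k] A} (J : DGIdeal 𝓐 d) (x : A) :
    J.quotD (Ideal.Quotient.mk J.ideal x) = Ideal.Quotient.mk J.ideal (d x) :=
  rfl

/-- Isomorphisms of multigraded DGAs over `S`: isomorphisms of `S`-algebras that respect the
homological degree and the multidegree and commute with the differentials. -/
structure DGAIso (𝓐 : ℕ × (Fin n → ℤ) → AddSubgroup A) (d : A →ₗ[MvPolynomial (Fin n) k] A)
    (𝓑 : ℕ × (Fin n → ℤ) → AddSubgroup B) (δ : B →ₗ[MvPolynomial (Fin n) k] B) where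
  toAlgEquiv : A ≃ₐ[MvPolynomial (Fin n) k] B
  map_grading : ∀ (p : ℕ × (Fin n → ℤ)) (x : A), toAlgEquiv x ∈ 𝓑 p ↔ x ∈ 𝓐 p
  map_d : ∀ x : A, toAlgEquiv (d x) = δ (toAlgEquiv x)

end DGA

/-! ### The Taylor resolution -/

section Taylor

variable {k : Type u} [Field k] {n : ℕ}

/-- The module underlying the Taylor resolution of `S/I`, free over `S = k[x₁, …, xₙ]` with basis
`g_W`, `W ⊆ G(I)`.  (`G(I)` is finite by Dickson's lemma.)  The signs in its structure depend on a
linear order on `G(I)`. -/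
def Taylor (I : Ideal (MvPolynomial (Fin n) k)) [LinearOrder (MinGen I)] : Type u :=
  Finset (MinGen I) →₀ MvPolynomial (Fin n) k

namespace Taylor

variable (I : Ideal (MvPolynomial (Fin n) k)) [LinearOrder (MinGen I)]

instance : AddCommGroup (Taylor I) :=
  inferInstanceAs (AddCommGroup (Finset (MinGen I) →₀ MvPolynomial (Fin n) k))

instance : Module (MvPolynomial (Fin n) k) (Taylor I) :=
  inferInstanceAs (Module (MvPolynomial (Fin n) k)
    (Finset (MinGen I) →₀ MvPolynomial (Fin n) k))

/-- The basis `g_W`, `W ⊆ G(I)`. -/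
def g : Module.Basis (Finset (MinGen I)) (MvPolynomial (Fin n) k) (Taylor I) :=
  Module.Basis.ofRepr (LinearEquiv.refl _ (Finset (MinGen I) →₀ MvPolynomial (Fin n) k))

variable {I}

/-- `σ(W, V) = #{(m, m') ∈ W × V : m' ≺ m}`. -/
def sigma (W V : Finset (MinGen I)) : ℕ :=
  ((W ×ˢ V).filter (fun q => q.2 < q.1)).card

/-- The coefficient `(-1)^σ(W,V) m_W m_V / m_{W ∪ V}` (or `0`, if `W` and `V` are not disjoint) of
`g_{W ∪ V}` in the product `g_W * g_V`. The subtraction of exponents is exact, since `m_{W ∪ V}`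
divides `m_W m_V`. -/
def mulCoeff (W V : Finset (MinGen I)) : MvPolynomial (Fin n) k :=
  if Disjoint W V then
    (-1) ^ sigma W V * MvPolynomial.monomial (lcmExp W + lcmExp V - lcmExp (W ∪ V)) 1
  else 0

variable (I)

/-- The multiplication of the Taylor resolution:
`g_W * g_V = (-1)^σ(W,V) (m_W m_V / m_{W ∪ V}) g_{W ∪ V}` if `W ∩ V = ∅`, and `0` otherwise. -/
def mulHom : Taylor I →ₗ[MvPolynomial (Fin n) k] Taylor I →ₗ[MvPolynomial (Fin n) k] Taylor I :=
  (g I).constr ℕ fun W => (g I).constr ℕ fun V => mulCoeff W V • g I (W ∪ V)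

/-- The differential of the Taylor resolution:
`∂ g_W = ∑_{m ∈ W} (-1)^#{m' ∈ W : m' ≺ m} (m_W / m_{W \ {m}}) g_{W \ {m}}`. -/
def d : Taylor I →ₗ[MvPolynomial (Fin n) k] Taylor I :=
  (g I).constr ℕ fun W => ∑ m ∈ W,
    ((-1) ^ (W.filter (fun m' => m' < m)).card *
      MvPolynomial.monomial (lcmExp W - lcmExp (W.erase m)) 1 : MvPolynomial (Fin n) k) •
        g I (W.erase m)

/-- The component of homological degree `i` and multidegree `a`, where `g_W` has homological
degree `#W` and the multidegree of `m_W`. -/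
def grading (p : ℕ × (Fin n → ℤ)) : AddSubgroup (Taylor I) where
  carrier := {t | ∀ W, ((g I).repr t W ≠ 0 → W.card = p.1) ∧
    (g I).repr t W ∈ polyGrading (fun j => p.2 j - (lcmExp W j : ℤ))}
  zero_mem' := by
    intro W
    simp [zero_mem]
  add_mem' := by
    intro s t hs ht W
    rw [map_add, Finsupp.add_apply]
    refine ⟨fun h => ?_, add_mem (hs W).2 (ht W).2⟩
    by_cases h0 : (g I).repr s W = 0
    · exact (ht W).1 (by simpa [h0] using h)
    · exact (hs W).1 h0
  neg_mem' := by
    intro t ht W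
    rw [map_neg, Finsupp.neg_apply]
    exact ⟨fun h => (ht W).1 (by simpa using h), neg_mem (ht W).2⟩

instance : Mul (Taylor I) := ⟨fun x y => mulHom I x y⟩

instance : One (Taylor I) := ⟨g I ∅⟩

theorem mul_def (x y : Taylor I) : x * y = mulHom I x y := rfl

theorem one_def : (1 : Taylor I) = g I ∅ := rfl

theorem g_mul_g (W V : Finset (MinGen I)) :
    g I W * g I V = (mulCoeff W V : MvPolynomial (Fin n) k) • g I (W ∪ V) := by
  simp [mul_def, mulHom, Module.Basis.constr_basis]

theorem d_g (W : Finset (MinGen I)) :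
    d I (g I W) = ∑ m ∈ W, ((-1) ^ (W.filter (fun m' => m' < m)).card *
      MvPolynomial.monomial (lcmExp W - lcmExp (W.erase m)) 1 : MvPolynomial (Fin n) k) •
        g I (W.erase m) := by
  simp [d, Module.Basis.constr_basis]

variable {I}

theorem lcmExp_union (W V : Finset (MinGen I)) : lcmExp (W ∪ V) = lcmExp W ⊔ lcmExp V :=
  Finset.sup_union

theorem sigma_union_left {W V : Finset (MinGen I)} (U : Finset (MinGen I)) (h : Disjoint W V) :
    sigma (W ∪ V) U = sigma W U + sigma V U := by
  unfold sigma
  rw [Finset.union_product, Finset.filter_union, Finset.card_union_of_disjoint]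
  refine Finset.disjoint_filter_filter ?_
  exact Finset.disjoint_product.2 (Or.inl h)

theorem sigma_union_right {V U : Finset (MinGen I)} (W : Finset (MinGen I)) (h : Disjoint V U) :
    sigma W (V ∪ U) = sigma W V + sigma W U := by
  unfold sigma
  rw [Finset.product_union, Finset.filter_union, Finset.card_union_of_disjoint]
  refine Finset.disjoint_filter_filter ?_
  exact Finset.disjoint_product.2 (Or.inr h)

theorem mulCoeff_assoc (W V U : Finset (MinGen I)) :
    (mulCoeff W V * mulCoeff (W ∪ V) U : MvPolynomial (Fin n) k) =
      mulCoeff V U * mulCoeff W (V ∪ U) := by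
  unfold mulCoeff
  by_cases h1 : Disjoint W V <;> by_cases h2 : Disjoint W U <;> by_cases h3 : Disjoint V U <;>
    simp only [Finset.disjoint_union_left, Finset.disjoint_union_right, h1, h2, h3, and_true,
      and_false, if_true, if_false, mul_zero, zero_mul]
  rw [sigma_union_left U h1, sigma_union_right W h3, pow_add, pow_add]
  have key : (lcmExp W + lcmExp V - lcmExp (W ∪ V)) +
      (lcmExp (W ∪ V) + lcmExp U - lcmExp (W ∪ V ∪ U)) =
      (lcmExp V + lcmExp U - lcmExp (V ∪ U)) +
      (lcmExp W + lcmExp (V ∪ U) - lcmExp (W ∪ (V ∪ U))) := by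
    ext j
    simp only [lcmExp_union, Finsupp.add_apply, Finsupp.tsub_apply, Finsupp.sup_apply]
    omega
  have e : ∀ p q : Fin n →₀ ℕ, (MvPolynomial.monomial (p + q) (1 : k)) =
      MvPolynomial.monomial p 1 * MvPolynomial.monomial q 1 := by
    intro p q; simp [MvPolynomial.monomial_mul]
  have := congrArg (fun q => MvPolynomial.monomial q (1 : k)) key
  simp only [e] at this
  linear_combination ((-1) ^ sigma W V * (-1) ^ sigma W U * (-1) ^ sigma V U) * this

variable (I)

theorem mul_smul' (c : MvPolynomial (Fin n) k) (x y : Taylor I) : x * (c • y) = c • (x * y) := by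
  simp [mul_def]

theorem smul_mul' (c : MvPolynomial (Fin n) k) (x y : Taylor I) : (c • x) * y = c • (x * y) := by
  simp [mul_def]

theorem one_mul' (x : Taylor I) : 1 * x = x := by
  have : mulHom I 1 = LinearMap.id := by
    refine (g I).ext fun W => ?_
    rw [← mul_def, one_def, g_mul_g]
    simp [mulCoeff, sigma, lcmExp_empty]
  rw [mul_def, this, LinearMap.id_apply]

theorem mul_one' (x : Taylor I) : x * 1 = x := by
  have : (mulHom I).flip 1 = LinearMap.id := by
    refine (g I).ext fun W => ?_
    rw [LinearMap.flip_apply, ← mul_def, one_def, g_mul_g]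
    simp [mulCoeff, sigma, lcmExp_empty]
  rw [mul_def, ← LinearMap.flip_apply, this, LinearMap.id_apply]

theorem induction_g {P : Taylor I → Prop} (x : Taylor I) (hg : ∀ W, P (g I W)) (h0 : P 0)
    (hadd : ∀ x y, P x → P y → P (x + y))
    (hsmul : ∀ (c : MvPolynomial (Fin n) k) (x), P x → P (c • x)) : P x := by
  have hx : x ∈ Submodule.span (MvPolynomial (Fin n) k) (Set.range (g I)) := by
    rw [(g I).span_eq]; trivial
  induction hx using Submodule.span_induction with
  | mem x h => obtain ⟨W, rfl⟩ := h; exact hg W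
  | zero => exact h0
  | add x y _ _ hx hy => exact hadd x y hx hy
  | smul c x _ hx => exact hsmul c x hx

theorem mul_add' (x y z : Taylor I) : x * (y + z) = x * y + x * z := by
  simp [mul_def]

theorem add_mul' (x y z : Taylor I) : (x + y) * z = x * z + y * z := by
  simp [mul_def]

theorem zero_mul' (x : Taylor I) : 0 * x = 0 := by
  simp [mul_def]

theorem mul_zero' (x : Taylor I) : x * 0 = 0 := by
  simp [mul_def]

theorem mul_assoc' (x y z : Taylor I) : x * y * z = x * (y * z) := by
  refine induction_g I (P := fun x => x * y * z = x * (y * z)) x (fun W => ?_) (by simp only [zero_mul'])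
    (fun a b ha hb => by simp only [add_mul', ha, hb])
    (fun c a ha => by simp only [smul_mul', ha])
  refine induction_g I (P := fun y => g I W * y * z = g I W * (y * z)) y (fun V => ?_) (by simp only [zero_mul', mul_zero'])
    (fun a b ha hb => by simp only [add_mul', mul_add', ha, hb])
    (fun c a ha => by simp only [smul_mul', mul_smul', ha])
  refine induction_g I (P := fun z => g I W * g I V * z = g I W * (g I V * z)) z (fun U => ?_) (by simp only [mul_zero'])
    (fun a b ha hb => by simp only [mul_add', ha, hb])
    (fun c a ha => by simp only [mul_smul', ha])
  simp only [g_mul_g, smul_mul', mul_smul', smul_smul, mulCoeff_assoc, Finset.union_assoc]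

instance : Ring (Taylor I) :=
  { (inferInstance : AddCommGroup (Taylor I)) with
    mul := fun x y => x * y
    one := 1
    left_distrib := mul_add' I
    right_distrib := add_mul' I
    zero_mul := zero_mul' I
    mul_zero := mul_zero' I
    mul_assoc := mul_assoc' I
    one_mul := one_mul' I
    mul_one := mul_one' I }

instance : Algebra (MvPolynomial (Fin n) k) (Taylor I) :=
  Algebra.ofModule (smul_mul' I) (mul_smul' I)

end Taylor

end Taylor

end TaylorDGA

end

namespace TaylorDGA

open MvPolynomial

/-! ### Homogeneous elements, monomial multiples and the submodule `𝔪 A` -/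

section GradedModule

variable {k : Type*} [Field k] {n : ℕ}

/-! Since `I` is squarefree, the multidegrees of a homogeneous basis of `F` have all entries `0` or
`1` (`deg_squarefree`). This gives a division principle: a homogeneous element of multidegree `c +
a'` is divisible by `x^c` as soon as `a' ≥ 1` on the support of `c` (`exists_eq_monomial_smul`).

Lift each minimal generator `m` to `f m` of homological degree one with `d (f m) = m`. The ordered
product of the `f m`, `m ∈ W`, has multidegree `∏ m`, so it is divisible by `∏ m / m_W`. The
quotients `y W` satisfy the Taylor formulas, because these hold after multiplication by a monomial
and `F` is torsion-free. Besides graded commutativity this needs `f m * f m = 0`, which is again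
obtained by division (`mul_self_eq_zero`). So `g_W ↦ y W` is a morphism of DGAs
(`exists_taylor_hom`).

It is surjective (`basis_mem_range`): if `m` divides the multidegree of a basis element `e`, then `f
m * e = m y` by division, and the Leibniz rule gives `e = d y + (f m * d e) / m`. The last term is
in the image by induction on the homological degree. By minimality `d y` lies in `𝔪 F`, so it only
involves basis elements of smaller total degree. A suitable `m` exists for every `e` of positive
homological degree, because `F` vanishes there in multidegrees outside `I` (`eq_zero_of_notMem`).
The DG-ideal is the kernel. -/

theorem monomial_mem_polyGrading (c : Fin n →₀ ℕ) (r : k) :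
    monomial c r ∈ polyGrading (k := k) fun j => (c j : ℤ) := by
  classical
  intro e he j
  rw [coeff_monomial] at he
  split_ifs at he with h
  · rw [h]
  · exact absurd rfl he

theorem eq_zero_or_monomial_of_mem_polyGrading {a : Fin n → ℤ} {p : MvPolynomial (Fin n) k}
    (hp : p ∈ polyGrading a) :
    p = 0 ∨ ∃ c : Fin n →₀ ℕ, (∀ j, (c j : ℤ) = a j) ∧ p = monomial c (coeff c p) := by
  classical
  by_cases h0 : p = 0
  · exact Or.inl h0
  obtain ⟨c, hc⟩ := ne_zero_iff.1 h0
  refine Or.inr ⟨c, hp c hc, ?_⟩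
  ext e
  rw [coeff_monomial]
  split_ifs with h
  · rw [h]
  · by_contra he
    refine h (Finsupp.ext fun j => ?_)
    have := hp c hc j
    have := hp e he j
    omega

theorem monomial_mem_of_monomial_mem {I : Ideal (MvPolynomial (Fin n) k)} {c : Fin n →₀ ℕ} {r : k}
    (hr : r ≠ 0) (h : monomial c r ∈ I) : monomial c (1 : k) ∈ I := by
  have := I.mul_mem_left (C r⁻¹) h
  rwa [C_mul_monomial, inv_mul_cancel₀ hr] at this

/-- A squarefree generator dividing `x_j x^c` has exponent at most `1` at `j`, so it already divides
`x^c` when `c j ≥ 1`. This is where squarefreeness of `I` enters. -/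
theorem IsSquarefreeMonomialIdeal.monomial_sub_mem {I : Ideal (MvPolynomial (Fin n) k)}
    (hI : IsSquarefreeMonomialIdeal I) {c : Fin n →₀ ℕ} {j : Fin n} (hj : 1 ≤ c j)
    (h : monomial (Finsupp.single j 1 + c) (1 : k) ∈ I) : monomial c (1 : k) ∈ I := by
  classical
  obtain ⟨M, hM, rfl⟩ := hI
  rw [mem_ideal_span_monomial_image] at h ⊢
  intro e he
  rw [support_monomial, if_neg one_ne_zero, Finset.mem_singleton] at he
  subst he
  obtain ⟨s, hs, hle⟩ := h (Finsupp.single j 1 + e)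
    (by rw [support_monomial, if_neg one_ne_zero, Finset.mem_singleton])
  refine ⟨s, hs, fun l => ?_⟩
  by_cases hl : l = j
  · subst hl
    exact (hM s hs l).trans hj
  · have := hle l
    rwa [Finsupp.add_apply, Finsupp.single_eq_of_ne hl, zero_add] at this

theorem exists_minGen_le {I : Ideal (MvPolynomial (Fin n) k)} {c : Fin n →₀ ℕ}
    (h : monomial c (1 : k) ∈ I) : ∃ m : MinGen I, m.exponent ≤ c := by
  obtain ⟨e, hle, he⟩ := exists_minimal_le_of_wellFoundedLT
    (fun e' => monomial e' (1 : k) ∈ I) c h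
  exact ⟨⟨e, he⟩, hle⟩

variable {A : Type*} [Ring A] [Algebra (MvPolynomial (Fin n) k) A]
variable {𝓐 : ℕ × (Fin n → ℤ) → AddSubgroup A} [GradedRing 𝓐]
variable {d : A →ₗ[MvPolynomial (Fin n) k] A}

theorem IsMultigradedDGA.smul_mem (h : IsMultigradedDGA 𝓐 d) {i : ℕ} {a b : Fin n → ℤ}
    (c : Fin n →₀ ℕ) (r : k) {x : A} (hx : x ∈ 𝓐 (i, a)) (hb : ∀ j, b j = c j + a j) :
    monomial c r • x ∈ 𝓐 (i, b) := by
  rw [Algebra.smul_def]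
  have := SetLike.mul_mem_graded (h.algebraMap_mem _ _ (monomial_mem_polyGrading c r)) hx
  rwa [show ((0, fun j => (c j : ℤ)) : ℕ × (Fin n → ℤ)) + (i, a) = (i, b) from
    Prod.ext (zero_add i) (funext fun j => (hb j).symm)] at this

theorem IsMultigradedDGA.proj_smul (h : IsMultigradedDGA 𝓐 d) {i : ℕ} {a b : Fin n → ℤ}
    (c : Fin n →₀ ℕ) (r : k) (x : A) (hb : ∀ j, b j = c j + a j) :
    GradedRing.proj 𝓐 (i, b) (monomial c r • x) = monomial c r • GradedRing.proj 𝓐 (i, a) x := by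
  rw [Algebra.smul_def, Algebra.smul_def, GradedRing.proj_apply, GradedRing.proj_apply,
    ← DirectSum.coe_decompose_mul_add_of_left_mem 𝓐
      (h.algebraMap_mem _ _ (monomial_mem_polyGrading c r)),
    show ((0, fun j => (c j : ℤ)) : ℕ × (Fin n → ℤ)) + (i, a) = (i, b) from
      Prod.ext (zero_add i) (funext fun j => (hb j).symm)]

theorem proj_of_mem {p : ℕ × (Fin n → ℤ)} {x : A} (hx : x ∈ 𝓐 p) : GradedRing.proj 𝓐 p x = x :=
  DirectSum.decompose_of_mem_same 𝓐 hx

theorem proj_of_mem_ne {p q : ℕ × (Fin n → ℤ)} {x : A} (hx : x ∈ 𝓐 p) (hpq : p ≠ q) :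
    GradedRing.proj 𝓐 q x = 0 :=
  DirectSum.decompose_of_mem_ne 𝓐 hx hpq

theorem proj_mem (p : ℕ × (Fin n → ℤ)) (x : A) : GradedRing.proj 𝓐 p x ∈ 𝓐 p := by
  rw [GradedRing.proj_apply]
  exact SetLike.coe_mem _

theorem IsMultigradedDGA.d_proj (h : IsMultigradedDGA 𝓐 d) (i : ℕ) (a : Fin n → ℤ) (x : A) :
    d (GradedRing.proj 𝓐 (i + 1, a) x) = GradedRing.proj 𝓐 (i, a) (d x) := by
  induction x using DirectSum.Decomposition.inductionOn 𝓐 with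
  | zero => simp only [map_zero]
  | add x y hx hy => simp only [map_add, hx, hy]
  | @homogeneous p x =>
    obtain ⟨x, hx⟩ := x
    obtain ⟨i', a'⟩ := p
    dsimp only
    cases i' with
    | zero =>
      rw [h.d_zero a' x hx, proj_of_mem_ne hx (by simp), map_zero, map_zero]
    | succ i' =>
      by_cases e : i' = i ∧ a' = a
      · obtain ⟨rfl, rfl⟩ := e
        rw [proj_of_mem hx, proj_of_mem (h.d_mem _ _ _ hx)]
      · rw [proj_of_mem_ne hx (by simpa using e),
          proj_of_mem_ne (h.d_mem _ _ _ hx) (by simpa using e), map_zero]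

/-- A homogeneous element is a sum of homogeneous monomial multiples of elements of a
homogeneous basis. -/
theorem IsMultigradedDGA.mem_closure_basis (h : IsMultigradedDGA 𝓐 d) {ι : Type*}
    (b : Module.Basis ι (MvPolynomial (Fin n) k) A) {deg : ι → ℕ × (Fin n → ℤ)}
    (hb : ∀ e, b e ∈ 𝓐 (deg e)) {i : ℕ} {a : Fin n → ℤ} {x : A} (hx : x ∈ 𝓐 (i, a)) :
    x ∈ AddSubgroup.closure {y | ∃ (e : ι) (c : Fin n →₀ ℕ) (r : k), (deg e).1 = i ∧
      (∀ j, a j = c j + (deg e).2 j) ∧ y = monomial c r • b e} := by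
  classical
  rw [← proj_of_mem hx, ← b.linearCombination_repr x, Finsupp.linearCombination_apply,
    Finsupp.sum, map_sum]
  refine sum_mem fun e _ => ?_
  induction b.repr x e using MvPolynomial.induction_on' with
  | monomial c r =>
    by_cases he : (i, a) = ((deg e).1, fun j => (c j : ℤ) + (deg e).2 j)
    · rw [proj_of_mem (he ▸ h.smul_mem c r (hb e) fun _ => rfl)]
      rw [Prod.mk.injEq] at he
      exact AddSubgroup.subset_closure ⟨e, c, r, he.1.symm, fun j => congrFun he.2 j, rfl⟩
    · rw [proj_of_mem_ne (h.smul_mem c r (hb e) fun _ => rfl) (Ne.symm he)]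
      exact zero_mem _
  | add p q hp hq =>
    rw [add_smul, map_add]
    exact add_mem hp hq

/-- A homogeneous element of `𝔪 A` is a sum of multiples of homogeneous elements by variables. -/
theorem IsMultigradedDGA.mem_closure_X_smul (h : IsMultigradedDGA 𝓐 d) {i : ℕ} {a : Fin n → ℤ}
    {x : A} (hx : x ∈ 𝓐 (i, a))
    (hm : x ∈ Ideal.span (Set.range (X : Fin n → MvPolynomial (Fin n) k)) •
      (⊤ : Submodule (MvPolynomial (Fin n) k) A)) :
    x ∈ AddSubgroup.closure {y | ∃ (j : Fin n) (z : A),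
      z ∈ 𝓐 (i, fun l => a l - (Finsupp.single j 1 : Fin n →₀ ℕ) l) ∧
      y = monomial (Finsupp.single j 1) (1 : k) • z} := by
  rw [← proj_of_mem hx]
  refine Submodule.smul_induction_on hm (fun r hr y _ => ?_) fun y z hy hz => ?_
  · induction hr using Submodule.span_induction generalizing y with
    | mem r hr =>
      obtain ⟨j, rfl⟩ := hr
      rw [X, h.proj_smul (a := fun l => a l - (Finsupp.single j 1 : Fin n →₀ ℕ) l) _ _ _
        fun l => by ring]
      exact AddSubgroup.subset_closure ⟨j, _, proj_mem _ _, rfl⟩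
    | zero => simp
    | add p q _ _ hp hq =>
      rw [add_smul, map_add]
      exact add_mem (hp y trivial) (hq y trivial)
    | smul s p _ hp =>
      rw [smul_eq_mul, mul_comm, mul_smul]
      exact hp _ trivial
  · rw [map_add]
    exact add_mem hy hz

/-- The constant term of the `e`-th coordinate vanishes on `𝔪 A` and equals `1` at `b e`. Combined
with minimality, no basis element is a boundary. -/
theorem basis_notMem_smul_top {ι : Type*} (b : Module.Basis ι (MvPolynomial (Fin n) k) A) (e : ι) :
    b e ∉ Ideal.span (Set.range (X : Fin n → MvPolynomial (Fin n) k)) •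
      (⊤ : Submodule (MvPolynomial (Fin n) k) A) := by
  intro he
  have key : ∀ x ∈ Ideal.span (Set.range (X : Fin n → MvPolynomial (Fin n) k)) •
      (⊤ : Submodule (MvPolynomial (Fin n) k) A), constantCoeff (b.repr x e) = 0 := by
    intro x hx
    refine Submodule.smul_induction_on hx (fun r hr y _ => ?_) fun y z hy hz => ?_
    · have hle : Ideal.span (Set.range (X : Fin n → MvPolynomial (Fin n) k)) ≤
          RingHom.ker (constantCoeff (σ := Fin n) (R := k)) := by
        rw [Ideal.span_le]
        rintro _ ⟨j, rfl⟩
        simp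
      rw [map_smul, Finsupp.smul_apply, smul_eq_mul, map_mul, (RingHom.mem_ker).1 (hle hr),
        zero_mul]
    · rw [map_add, Finsupp.add_apply, map_add, hy, hz, add_zero]
  have := key _ he
  rw [Module.Basis.repr_self, Finsupp.single_eq_same, map_one] at this
  exact one_ne_zero this

end GradedModule

end TaylorDGA

namespace TaylorDGA

open MvPolynomial

/-! ### Multidegrees and divisibility in a minimal free resolution -/

section Resolution

variable {k : Type*} [Field k] {n : ℕ} {I : Ideal (MvPolynomial (Fin n) k)}
variable {A : Type*} [Ring A] [Algebra (MvPolynomial (Fin n) k) A]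
variable {𝓐 : ℕ × (Fin n → ℤ) → AddSubgroup A}
variable {d : A →ₗ[MvPolynomial (Fin n) k] A}
variable {ι : Type*} {b : Module.Basis ι (MvPolynomial (Fin n) k) A} {deg : ι → ℕ × (Fin n → ℤ)}

theorem monomial_smul_cancel (b : Module.Basis ι (MvPolynomial (Fin n) k) A) (c : Fin n →₀ ℕ)
    {x y : A} (h : monomial c (1 : k) • x = monomial c (1 : k) • y) : x = y := by
  have : Module.IsTorsionFree (MvPolynomial (Fin n) k) A := b.isTorsionFree
  refine smul_right_injective A (r := monomial c (1 : k)) ?_ h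
  rw [Ne, monomial_eq_zero]
  exact one_ne_zero

theorem monomial_mem_span_X {c : Fin n →₀ ℕ} (hc : c ≠ 0) (r : k) :
    monomial c r ∈ Ideal.span (Set.range (X : Fin n → MvPolynomial (Fin n) k)) := by
  obtain ⟨j, hj⟩ := Finsupp.ne_iff.1 hc
  have : monomial c r = monomial (c - Finsupp.single j 1) r * X j := by
    rw [X, monomial_mul, mul_one, tsub_add_cancel_of_le]
    rw [Finsupp.single_le_iff]
    exact Nat.one_le_iff_ne_zero.2 hj
  rw [this]
  exact Ideal.mul_mem_left _ _ (Ideal.subset_span ⟨j, rfl⟩)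

/-- Disposes of the degenerate case `A = 0`, that is `I = S`: `𝔪 A` absorbs left multiplication, so
containing `1` it would contain every basis element. -/
theorem eq_zero_of_one_mem_smul_top (b : Module.Basis ι (MvPolynomial (Fin n) k) A)
    (h : (1 : A) ∈ Ideal.span (Set.range (X : Fin n → MvPolynomial (Fin n) k)) •
      (⊤ : Submodule (MvPolynomial (Fin n) k) A)) (x : A) : x = 0 := by
  have hall : ∀ y ∈ Ideal.span (Set.range (X : Fin n → MvPolynomial (Fin n) k)) •
      (⊤ : Submodule (MvPolynomial (Fin n) k) A), ∀ x : A, x * y ∈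
      Ideal.span (Set.range (X : Fin n → MvPolynomial (Fin n) k)) •
      (⊤ : Submodule (MvPolynomial (Fin n) k) A) := by
    intro y hy x
    refine Submodule.smul_induction_on hy (fun r hr z _ => ?_) fun z w hz hw => ?_
    · rw [mul_smul_comm]
      exact Submodule.smul_mem_smul hr trivial
    · rw [mul_add]
      exact add_mem hz hw
  have hι : IsEmpty ι := ⟨fun e => basis_notMem_smul_top b e (by simpa using hall 1 h (b e))⟩
  exact b.repr.injective (Subsingleton.elim _ _)

theorem IsMinimalFreeResolution.exists_basis (h : IsMinimalFreeResolution I 𝓐 d) :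
    ∃ (X : Set A) (b : Module.Basis X (MvPolynomial (Fin n) k) A) (deg : X → ℕ × (Fin n → ℤ)),
      ∀ e, b e ∈ 𝓐 (deg e) := by
  obtain ⟨X, hX, hli, hspan⟩ := h.free
  choose! deg hdeg using hX
  refine ⟨X, Module.Basis.mk hli (by rw [Subtype.range_coe, hspan]), fun x => deg x, fun e => ?_⟩
  rw [Module.Basis.mk_apply]
  exact hdeg _ e.2

theorem IsMinimalFreeResolution.range_le (h : IsMinimalFreeResolution I 𝓐 d) {x : A}
    (hx : x ∈ LinearMap.range d) :
    x ∈ Ideal.span (Set.range (X : Fin n → MvPolynomial (Fin n) k)) •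
      (⊤ : Submodule (MvPolynomial (Fin n) k) A) := by
  obtain ⟨y, rfl⟩ := hx
  exact h.minimal y

theorem IsMinimalFreeResolution.mem_range (h : IsMinimalFreeResolution I 𝓐 d) {i : ℕ}
    {a : Fin n → ℤ} {x : A} (hx : x ∈ 𝓐 (i + 1, a)) (hd : d x = 0) : x ∈ LinearMap.range d := by
  obtain ⟨y, _, hy⟩ := h.exact i x (Submodule.subset_span ⟨a, hx⟩) hd
  exact ⟨y, hy⟩

variable [GradedRing 𝓐]

theorem one_mem_zero (𝓐 : ℕ × (Fin n → ℤ) → AddSubgroup A) [GradedRing 𝓐] :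
    (1 : A) ∈ 𝓐 (0, fun _ => 0) :=
  SetLike.one_mem_graded 𝓐

theorem IsMultigradedDGA.exists_of_mem_range (h : IsMultigradedDGA 𝓐 d) {i : ℕ} {a : Fin n → ℤ}
    {x : A} (hx : x ∈ 𝓐 (i, a)) (hr : x ∈ LinearMap.range d) : ∃ y ∈ 𝓐 (i + 1, a), d y = x := by
  obtain ⟨y, rfl⟩ := hr
  exact ⟨_, proj_mem _ y, by rw [h.d_proj, proj_of_mem hx]⟩

theorem IsMinimalFreeResolution.exists_augmentation (h : IsMinimalFreeResolution I 𝓐 d)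
    (hD : IsMultigradedDGA 𝓐 d) :
    ∃ ε : homologicalPart (k := k) 𝓐 0 →ₗ[MvPolynomial (Fin n) k] (MvPolynomial (Fin n) k ⧸ I),
      ∀ (a : Fin n → ℤ) (x : homologicalPart (k := k) 𝓐 0), (x : A) ∈ 𝓐 (0, a) →
        (ε x = 0 ↔ (x : A) ∈ LinearMap.range d) ∧
        ∃ p : MvPolynomial (Fin n) k, p ∈ polyGrading a ∧ ε x = Ideal.Quotient.mk I p := by
  obtain ⟨ε, -, hker, hgr⟩ := h.augmentation
  refine ⟨ε, fun a x hx => ⟨?_, hgr a x hx⟩⟩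
  rw [hker]
  constructor
  · rintro ⟨y, _, hy⟩
    exact ⟨y, hy⟩
  · intro hr
    obtain ⟨y, hy, hyx⟩ := hD.exists_of_mem_range hx hr
    exact ⟨y, Submodule.subset_span ⟨a, hy⟩, hyx⟩

/-- The augmentation sends `x^c • 1` to `x^c • ε 1`, which vanishes because `I` annihilates `S/I`.
For `c` a minimal generator this supplies `f m`. -/
theorem IsMinimalFreeResolution.smul_one_mem_range (h : IsMinimalFreeResolution I 𝓐 d)
    (hD : IsMultigradedDGA 𝓐 d) {c : Fin n →₀ ℕ} (hc : monomial c (1 : k) ∈ I) :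
    ∃ y ∈ 𝓐 (1, fun j => (c j : ℤ)), d y = monomial c (1 : k) • (1 : A) := by
  obtain ⟨ε, hε⟩ := h.exists_augmentation hD
  have hmem : monomial c (1 : k) • (1 : A) ∈ 𝓐 (0, fun j => (c j : ℤ)) :=
    hD.smul_mem c 1 (one_mem_zero 𝓐) fun j => by simp
  let u : homologicalPart (k := k) 𝓐 0 := ⟨1, Submodule.subset_span ⟨_, one_mem_zero 𝓐⟩⟩
  refine hD.exists_of_mem_range hmem (((hε _ (monomial c (1 : k) • u) hmem).1).1 ?_)
  obtain ⟨q, -, hq⟩ := (hε _ u (one_mem_zero 𝓐)).2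
  rw [map_smul, hq, ← Ideal.Quotient.mk_eq_mk, ← Submodule.Quotient.mk_smul,
    Submodule.Quotient.mk_eq_zero, smul_eq_mul]
  exact Ideal.mul_mem_right _ _ hc

/-- Substitute for exactness in homological degree zero: `ε z` is the class of a scalar times a
monomial divisible by `x_j`, and `monomial_sub_mem` removes the extra factor `x_j`. -/
theorem IsMinimalFreeResolution.mem_range_of_smul (h : IsMinimalFreeResolution I 𝓐 d)
    (hD : IsMultigradedDGA 𝓐 d) (hI : IsSquarefreeMonomialIdeal I) {a : Fin n → ℤ} {j : Fin n}
    (hj : 1 ≤ a j) {z : A} (hz : z ∈ 𝓐 (0, a))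
    (hr : monomial (Finsupp.single j 1) (1 : k) • z ∈ LinearMap.range d) :
    z ∈ LinearMap.range d := by
  obtain ⟨ε, hε⟩ := h.exists_augmentation hD
  let u : homologicalPart (k := k) 𝓐 0 := ⟨z, Submodule.subset_span ⟨_, hz⟩⟩
  refine (hε a u hz).1.1 ?_
  obtain ⟨q, hqa, hq⟩ := (hε a u hz).2
  have h0 := (hε _ (monomial (Finsupp.single j 1) (1 : k) • u)
    (hD.smul_mem _ 1 hz fun _ => rfl)).1.2 hr
  rw [map_smul, hq, ← Ideal.Quotient.mk_eq_mk, ← Submodule.Quotient.mk_smul,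
    Submodule.Quotient.mk_eq_zero, smul_eq_mul] at h0
  rw [hq]
  obtain rfl | ⟨c, hc, hqc⟩ := eq_zero_or_monomial_of_mem_polyGrading hqa
  · exact map_zero _
  rw [Ideal.Quotient.eq_zero_iff_mem]
  rw [hqc] at h0 ⊢
  generalize coeff c q = r at *
  by_cases hr0 : r = 0
  · rw [hr0, monomial_zero]
    exact zero_mem _
  rw [monomial_mul, one_mul] at h0
  have := hI.monomial_sub_mem (by have := hc j; omega) (monomial_mem_of_monomial_mem hr0 h0)
  have h1 := I.mul_mem_left (C r) this
  rwa [C_mul_monomial, mul_one] at h1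

/-- The augmentation need not send `1` to `1`, but `ε 1` is a nonzero class of multidegree `0`,
hence the class of a nonzero scalar `r`. Dividing by `r` shows that `1` generates homological degree
zero modulo boundaries, with annihilator contained in `I`. -/
theorem IsMinimalFreeResolution.exists_sub_smul_one_mem_range
    (h : IsMinimalFreeResolution I 𝓐 d) (hD : IsMultigradedDGA 𝓐 d)
    (h1 : (1 : A) ∉ Ideal.span (Set.range (X : Fin n → MvPolynomial (Fin n) k)) •
      (⊤ : Submodule (MvPolynomial (Fin n) k) A)) {a : Fin n → ℤ} {x : A} (hx : x ∈ 𝓐 (0, a)) :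
    (∃ p : MvPolynomial (Fin n) k, p ∈ polyGrading a ∧ x - p • 1 ∈ LinearMap.range d) ∧
    ∀ p : MvPolynomial (Fin n) k, p ∈ polyGrading a → p • (1 : A) ∈ LinearMap.range d → p ∈ I := by
  obtain ⟨ε, hε⟩ := h.exists_augmentation hD
  let u : homologicalPart (k := k) 𝓐 0 := ⟨1, Submodule.subset_span ⟨_, one_mem_zero 𝓐⟩⟩
  let v : homologicalPart (k := k) 𝓐 0 := ⟨x, Submodule.subset_span ⟨_, hx⟩⟩
  obtain ⟨q, hq0, hq⟩ := (hε _ u (one_mem_zero 𝓐)).2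
  obtain ⟨p, hp, hpv⟩ := (hε _ v hx).2
  have hu : ε u ≠ 0 := fun h0 => h1 (h.range_le ((hε _ u (one_mem_zero 𝓐)).1.1 h0))
  obtain ⟨r, hr, rfl⟩ : ∃ r : k, r ≠ 0 ∧ q = C r := by
    obtain rfl | ⟨c, hc, hqc⟩ := eq_zero_or_monomial_of_mem_polyGrading hq0
    · exact absurd (by rw [hq, map_zero]) hu
    · have hc0 : c = 0 := Finsupp.ext fun j => by simpa using hc j
      subst hc0
      refine ⟨_, fun h0 => hu ?_, hqc⟩
      rw [hq, hqc, h0, monomial_zero, map_zero]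
  have hmem : ∀ p : MvPolynomial (Fin n) k, p ∈ polyGrading a → p • (1 : A) ∈ 𝓐 (0, a) := by
    intro p hp
    rw [Algebra.smul_def, mul_one]
    exact hD.algebraMap_mem a p hp
  have hsm : ∀ p : MvPolynomial (Fin n) k, ε (p • u) = Ideal.Quotient.mk I (p * C r) := by
    intro p
    rw [map_smul, hq, ← Ideal.Quotient.mk_eq_mk, ← Submodule.Quotient.mk_smul, smul_eq_mul]
    rfl
  refine ⟨⟨C r⁻¹ * p, ?_, ?_⟩, fun p hp hr' => ?_⟩
  · intro e he
    rw [coeff_C_mul] at he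
    exact hp e (right_ne_zero_of_mul he)
  · have hp' : C r⁻¹ * p ∈ polyGrading a := by
      intro e he
      rw [coeff_C_mul] at he
      exact hp e (right_ne_zero_of_mul he)
    refine (hε a (v - (C r⁻¹ * p) • u) (sub_mem hx (hmem _ hp'))).1.1 ?_
    rw [map_sub, hsm, hpv, mul_right_comm, ← C_mul, inv_mul_cancel₀ hr, C_1, one_mul, sub_self]
  · have h0 := (hε a (p • u) (hmem p hp)).1.2 hr'
    rw [hsm, Ideal.Quotient.eq_zero_iff_mem] at h0
    have := I.mul_mem_right (C r⁻¹) h0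
    rwa [mul_assoc, ← C_mul, mul_inv_cancel₀ hr, C_1, mul_one] at this

theorem IsMultigradedDGA.eq_zero_of_mem_smul_top (hD : IsMultigradedDGA 𝓐 d) {i : ℕ}
    {a : Fin n → ℤ} {x : A} (hx : x ∈ 𝓐 (i, a))
    (hm : x ∈ Ideal.span (Set.range (X : Fin n → MvPolynomial (Fin n) k)) •
      (⊤ : Submodule (MvPolynomial (Fin n) k) A))
    (hz : ∀ (j : Fin n), ∀ z ∈ 𝓐 (i, fun l => a l - (Finsupp.single j 1 : Fin n →₀ ℕ) l), z = 0) :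
    x = 0 := by
  have hcl := hD.mem_closure_X_smul hx hm
  clear hx hm
  induction hcl using AddSubgroup.closure_induction with
  | mem x hx =>
    obtain ⟨j, z, hzm, rfl⟩ := hx
    rw [hz j z hzm, smul_zero]
  | zero => rfl
  | add x y _ _ hx hy => rw [hx, hy, add_zero]
  | neg x _ hx => rw [hx, neg_zero]

theorem IsMultigradedDGA.eq_zero_of_neg (hD : IsMultigradedDGA 𝓐 d) (hb : ∀ e, b e ∈ 𝓐 (deg e))
    {i : ℕ} (hdeg : ∀ e, (deg e).1 = i → ∀ j, 0 ≤ (deg e).2 j ∧ (deg e).2 j ≤ 1)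
    {a : Fin n → ℤ} {x : A} (hx : x ∈ 𝓐 (i, a)) {j : Fin n} (hj : a j < 0) : x = 0 := by
  have hcl := hD.mem_closure_basis b hb hx
  clear hx
  induction hcl using AddSubgroup.closure_induction with
  | mem x hx =>
    obtain ⟨e, c, r, he, ha, rfl⟩ := hx
    have := ha j
    have := hdeg e he j
    omega
  | zero => rfl
  | add x y _ _ hx hy => rw [hx, hy, add_zero]
  | neg x _ hx => rw [hx, neg_zero]

/-- The division principle. In a term `x^{c'} b e` of multidegree `a`, the entries of `deg e` are at
most `1 ≤ a' j` wherever `c j ≠ 0`, so `c' j = c j + a' j - (deg e).2 j ≥ c j`. -/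
theorem IsMultigradedDGA.exists_eq_monomial_smul (hD : IsMultigradedDGA 𝓐 d)
    (hb : ∀ e, b e ∈ 𝓐 (deg e)) {i : ℕ}
    (hdeg : ∀ e, (deg e).1 = i → ∀ j, 0 ≤ (deg e).2 j ∧ (deg e).2 j ≤ 1)
    {a a' : Fin n → ℤ} {x : A} (hx : x ∈ 𝓐 (i, a)) (c : Fin n →₀ ℕ) (hc : ∀ j, a j = c j + a' j)
    (ha' : ∀ j, c j ≠ 0 → 1 ≤ a' j) : ∃ y ∈ 𝓐 (i, a'), x = monomial c (1 : k) • y := by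
  have hcl := hD.mem_closure_basis b hb hx
  clear hx
  induction hcl using AddSubgroup.closure_induction with
  | mem x hx =>
    obtain ⟨e, c', r, rfl, ha, rfl⟩ := hx
    have hle : c ≤ c' := fun j => by
      have := hc j
      have := ha j
      have := hdeg e rfl j
      have := ha' j
      omega
    refine ⟨monomial (c' - c) r • b e, hD.smul_mem _ _ (hb e) fun j => ?_, ?_⟩
    · have := hc j
      have := ha j
      have := hle j
      rw [Finsupp.tsub_apply]
      omega
    · rw [smul_smul, monomial_mul, one_mul, add_tsub_cancel_of_le hle]
  | zero => exact ⟨0, zero_mem _, by rw [smul_zero]⟩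
  | add x y _ _ hx hy =>
    obtain ⟨x', hx', rfl⟩ := hx
    obtain ⟨y', hy', rfl⟩ := hy
    exact ⟨x' + y', add_mem hx' hy', by rw [smul_add]⟩
  | neg x _ hx =>
    obtain ⟨x', hx', rfl⟩ := hx
    exact ⟨-x', neg_mem hx', by rw [smul_neg]⟩

/-- Modulo boundaries, `b e` is `p • 1` with `p` of the same multidegree. If that were nonzero, `p`
would lie in `𝔪`, and then `b e` would lie in `𝔪 A`. -/
theorem IsMinimalFreeResolution.deg_eq_zero (h : IsMinimalFreeResolution I 𝓐 d)
    (hD : IsMultigradedDGA 𝓐 d) (hb : ∀ e, b e ∈ 𝓐 (deg e)) {e : ι} (he : (deg e).1 = 0)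
    (j : Fin n) : (deg e).2 j = 0 := by
  have h1 : (1 : A) ∉ Ideal.span (Set.range (X : Fin n → MvPolynomial (Fin n) k)) •
      (⊤ : Submodule (MvPolynomial (Fin n) k) A) := fun h1 =>
    b.ne_zero e (eq_zero_of_one_mem_smul_top b h1 _)
  have hbe : b e ∈ 𝓐 (0, (deg e).2) := by
    rw [← he]
    exact hb e
  obtain ⟨p, hp, hr⟩ := (h.exists_sub_smul_one_mem_range hD h1 hbe).1
  by_contra hj
  refine basis_notMem_smul_top b e ?_
  rw [← sub_add_cancel (b e) (p • 1)]
  refine add_mem (h.range_le hr) ?_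
  obtain rfl | ⟨c, hc, hpc⟩ := eq_zero_or_monomial_of_mem_polyGrading hp
  · rw [zero_smul]
    exact zero_mem _
  · rw [hpc]
    refine Submodule.smul_mem_smul (monomial_mem_span_X (fun h0 => hj ?_) _) trivial
    rw [← hc, h0]
    rfl

/-- The multidegrees of a homogeneous basis of a minimal free resolution of a squarefree monomial
ideal are squarefree. -/
theorem IsMinimalFreeResolution.deg_squarefree (h : IsMinimalFreeResolution I 𝓐 d)
    (hD : IsMultigradedDGA 𝓐 d) (hI : IsSquarefreeMonomialIdeal I)
    (hb : ∀ e, b e ∈ 𝓐 (deg e)) (i : ℕ) :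
    ∀ e, (deg e).1 = i → ∀ j, 0 ≤ (deg e).2 j ∧ (deg e).2 j ≤ 1 := by
  induction i with
  | zero =>
    intro e he j
    rw [h.deg_eq_zero hD hb he]
    decide
  | succ i ih =>
    intro e he j
    have hbe : b e ∈ 𝓐 (i + 1, (deg e).2) := by
      rw [← he]
      exact hb e
    have hdbe := hD.d_mem _ _ _ hbe
    by_contra! hj
    -- With a negative entry, `d (b e)` vanishes by the induction hypothesis, so `b e` would be a
    -- boundary.
    by_cases hneg : (deg e).2 j < 0
    · exact basis_notMem_smul_top b e (h.range_le (h.mem_range hbe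
        (hD.eq_zero_of_neg hb ih hdbe hneg)))
    · have h2 : 1 < (deg e).2 j := hj (not_lt.1 hneg)
      let a' : Fin n → ℤ := fun l => (deg e).2 l - (Finsupp.single j 1 : Fin n →₀ ℕ) l
      have ha' : 1 ≤ a' j := by
        simp only [a', Finsupp.single_eq_same]
        omega
      -- With an entry at least `2`, one factor `x_j` can be split off `d (b e)`, leaving a
      -- multidegree still positive at `j`.
      obtain ⟨z, hz, hdz⟩ := hD.exists_eq_monomial_smul hb ih (a' := a') hdbe (Finsupp.single j 1)
        (fun l => by simp [a']) (fun l hl => by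
          have : l = j := by
            by_contra hne
            exact hl (Finsupp.single_eq_of_ne hne)
          subst this
          exact ha')
      -- In positive homological degree `z` is a cycle by cancellation of `x_j`; in degree zero
      -- squarefreeness of `I` is needed instead.
      have hzr : z ∈ LinearMap.range d := by
        cases i with
        | zero => exact h.mem_range_of_smul hD hI ha' hz ⟨_, hdz⟩
        | succ i =>
          refine h.mem_range hz (monomial_smul_cancel b (Finsupp.single j 1) ?_)
          rw [← map_smul, ← hdz, hD.d_d, smul_zero]
      obtain ⟨y, hy, rfl⟩ := hD.exists_of_mem_range hz hzr
      -- Now `d (b e) = x_j d y`, so `b e` is `x_j y` plus a cycle, hence plus a boundary; both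
      -- summands lie in `𝔪 A`.
      have hcyc : b e - monomial (Finsupp.single j 1) (1 : k) • y ∈ LinearMap.range d := by
        refine h.mem_range (sub_mem hbe (hD.smul_mem _ _ hy fun l => by simp [a'])) ?_
        rw [map_sub, map_smul, hdz, sub_self]
      refine basis_notMem_smul_top b e ?_
      rw [← sub_add_cancel (b e) (monomial (Finsupp.single j 1) (1 : k) • y)]
      exact add_mem (h.range_le hcyc) (Submodule.smul_mem_smul (Ideal.subset_span ⟨j, rfl⟩) trivial)

/-- For a basis element of homological degree zero, the boundary `b e - p • 1` lies in `𝔪 A` and has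
multidegree `0`. It is zero, since its coefficients along the variables would have a negative
multidegree. -/
theorem IsMinimalFreeResolution.exists_eq_smul_one (h : IsMinimalFreeResolution I 𝓐 d)
    (hD : IsMultigradedDGA 𝓐 d) (hb : ∀ e, b e ∈ 𝓐 (deg e)) {a : Fin n → ℤ} {x : A}
    (hx : x ∈ 𝓐 (0, a)) : ∃ p : MvPolynomial (Fin n) k, p ∈ polyGrading a ∧ x = p • 1 := by
  have hdeg : ∀ e, (deg e).1 = 0 → ∀ j, 0 ≤ (deg e).2 j ∧ (deg e).2 j ≤ 1 := by
    intro e he j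
    rw [h.deg_eq_zero hD hb he]
    decide
  by_cases h1 : (1 : A) ∈ Ideal.span (Set.range (X : Fin n → MvPolynomial (Fin n) k)) •
      (⊤ : Submodule (MvPolynomial (Fin n) k) A)
  · exact ⟨0, zero_mem _, eq_zero_of_one_mem_smul_top b h1 _ |>.trans (by rw [zero_smul])⟩
  have hcl := hD.mem_closure_basis b hb hx
  clear hx
  induction hcl using AddSubgroup.closure_induction with
  | mem x hx =>
    obtain ⟨e, c, r, he, ha, rfl⟩ := hx
    have hz : (deg e).2 = fun _ => 0 := funext fun j => h.deg_eq_zero hD hb he j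
    have hbe : b e ∈ 𝓐 (0, fun _ => 0) := by
      rw [← he, ← hz]
      exact hb e
    obtain ⟨p, hp, hr⟩ := (h.exists_sub_smul_one_mem_range hD h1 hbe).1
    have hmem : b e - p • 1 ∈ 𝓐 (0, fun _ => 0) := by
      refine sub_mem hbe ?_
      rw [Algebra.smul_def, mul_one]
      exact hD.algebraMap_mem _ p hp
    have h0 : b e - p • 1 = 0 := by
      refine hD.eq_zero_of_mem_smul_top hmem (h.range_le hr) fun j z hz => ?_
      exact hD.eq_zero_of_neg hb hdeg hz (j := j) (by simp)
    refine ⟨monomial c r * p, ?_, ?_⟩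
    · obtain rfl | ⟨c', hc', hpc⟩ := eq_zero_or_monomial_of_mem_polyGrading hp
      · rw [mul_zero]
        exact zero_mem _
      · have hc0 : c' = 0 := Finsupp.ext fun j => by simpa using hc' j
        rw [hpc, monomial_mul, hc0, add_zero]
        rw [show a = fun j => (c j : ℤ) from funext fun j => by rw [ha j, hz, add_zero]]
        exact monomial_mem_polyGrading c _
    · rw [mul_smul, ← sub_eq_zero.1 h0]
  | zero => exact ⟨0, zero_mem _, by rw [zero_smul]⟩
  | add x y _ _ hx hy =>
    obtain ⟨p, hp, rfl⟩ := hx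
    obtain ⟨q, hq, rfl⟩ := hy
    exact ⟨p + q, add_mem hp hq, by rw [add_smul]⟩
  | neg x _ hx =>
    obtain ⟨p, hp, rfl⟩ := hx
    exact ⟨-p, neg_mem hp, by rw [neg_smul]⟩

/-- Monomials outside `I` are closed under divisors, so a basis element contributing to multidegree
`a` also lives outside `I`. By `hd` it would be a cycle, hence a boundary, which is impossible. -/
theorem IsMinimalFreeResolution.eq_zero_of_d_eq_zero (h : IsMinimalFreeResolution I 𝓐 d)
    (hD : IsMultigradedDGA 𝓐 d) (hb : ∀ e, b e ∈ 𝓐 (deg e)) {i : ℕ}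
    (hd : ∀ {a : Fin n → ℤ}, (∀ c : Fin n →₀ ℕ, (∀ j, (c j : ℤ) = a j) →
      monomial c (1 : k) ∉ I) → ∀ {x : A}, x ∈ 𝓐 (i + 1, a) → d x = 0)
    {a : Fin n → ℤ} (ha : ∀ c : Fin n →₀ ℕ, (∀ j, (c j : ℤ) = a j) → monomial c (1 : k) ∉ I)
    {x : A} (hx : x ∈ 𝓐 (i + 1, a)) : x = 0 := by
  have hcl := hD.mem_closure_basis b hb hx
  clear hx
  induction hcl using AddSubgroup.closure_induction with
  | mem x hx =>
    obtain ⟨e, c, r, he, hc, rfl⟩ := hx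
    have hbe : b e ∈ 𝓐 (i + 1, (deg e).2) := by
      rw [← he]
      exact hb e
    refine absurd (h.range_le (h.mem_range hbe (hd (fun c' hc' hmem => ?_) hbe)))
      (basis_notMem_smul_top b e)
    refine ha (c + c') (fun j => ?_) ?_
    · rw [hc, ← hc', Finsupp.add_apply, Nat.cast_add]
    · have := I.mul_mem_left (monomial c 1) hmem
      rwa [monomial_mul, mul_one] at this
  | zero => rfl
  | add x y _ _ hx hy => rw [hx, hy, add_zero]
  | neg x _ hx => rw [hx, neg_zero]

/-- A minimal free resolution of `S/I` vanishes, in positive homological degrees, in the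
multidegrees of the monomials outside `I`. -/
theorem IsMinimalFreeResolution.eq_zero_of_notMem (h : IsMinimalFreeResolution I 𝓐 d)
    (hD : IsMultigradedDGA 𝓐 d) (hb : ∀ e, b e ∈ 𝓐 (deg e))
    (i : ℕ) : ∀ {a : Fin n → ℤ}, (∀ c : Fin n →₀ ℕ, (∀ j, (c j : ℤ) = a j) →
      monomial c (1 : k) ∉ I) → ∀ {x : A}, x ∈ 𝓐 (i + 1, a) → x = 0 := by
  induction i with
  | zero =>
    refine h.eq_zero_of_d_eq_zero hD hb fun {a} ha {x} hx => ?_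
    by_cases h1 : (1 : A) ∈ Ideal.span (Set.range (X : Fin n → MvPolynomial (Fin n) k)) •
        (⊤ : Submodule (MvPolynomial (Fin n) k) A)
    · exact eq_zero_of_one_mem_smul_top b h1 _
    obtain ⟨p, hp, hdx⟩ := h.exists_eq_smul_one hD hb (hD.d_mem _ _ _ hx)
    have hpI := (h.exists_sub_smul_one_mem_range hD h1 (hD.d_mem _ _ _ hx)).2 p hp ⟨x, hdx⟩
    obtain rfl | ⟨c, hc, hpc⟩ := eq_zero_or_monomial_of_mem_polyGrading hp
    · rw [hdx, zero_smul]
    · by_cases hr : coeff c p = 0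
      · rw [hdx, hpc, hr, monomial_zero, zero_smul]
      · rw [hpc] at hpI
        exact absurd (monomial_mem_of_monomial_mem hr hpI) (ha c hc)
  | succ i ih =>
    exact h.eq_zero_of_d_eq_zero hD hb fun {a} ha {x} hx => ih ha (hD.d_mem _ _ _ hx)

/-- The square of an element of homological degree one in the multidegree of a minimal generator
vanishes; in characteristic two, this does not follow from graded commutativity. -/
theorem IsMinimalFreeResolution.mul_self_eq_zero (h : IsMinimalFreeResolution I 𝓐 d)
    (hD : IsMultigradedDGA 𝓐 d) (hI : IsSquarefreeMonomialIdeal I) (hb : ∀ e, b e ∈ 𝓐 (deg e))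
    (m : MinGen I) {f : A} (hf : f ∈ 𝓐 (1, fun j => (m.exponent j : ℤ))) : f * f = 0 := by
  have hff : f * f ∈ 𝓐 (2, fun j => (m.exponent j : ℤ) + m.exponent j) :=
    SetLike.mul_mem_graded hf hf
  -- Division by `m` moves the question from multidegree `2m` to multidegree `m`, where `y` turns
  -- out to be a cycle.
  obtain ⟨y, hy, hfy⟩ := hD.exists_eq_monomial_smul hb (h.deg_squarefree hD hI hb 2) hff
    (a' := fun j => (m.exponent j : ℤ)) m.exponent (fun _ => rfl) (fun j hj => by omega)
  have hdf : d f ∈ 𝓐 (0, fun j => (m.exponent j : ℤ)) := hD.d_mem _ _ _ hf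
  have hd : d (f * f) = 0 := by
    rw [hD.leibniz _ _ _ _ hf, hD.graded_comm _ _ _ _ _ _ hdf hf]
    simp
  have hdy : d y = 0 := by
    refine monomial_smul_cancel b m.exponent ?_
    rw [← map_smul, ← hfy, hd, smul_zero]
  -- As a boundary, `y` is a sum of elements `x_j z` with `z` of multidegree `m / x_j`. That
  -- monomial is outside `I` by minimality of `m`, so `z = 0`.
  have hy0 : y = 0 := by
    refine hD.eq_zero_of_mem_smul_top hy (h.range_le (h.mem_range hy hdy)) fun j z hz => ?_
    refine h.eq_zero_of_notMem hD hb 1 (fun c hc hmem => ?_) hz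
    have hle : c ≤ m.exponent := fun l => by
      have := hc l
      omega
    have h1 := hc j
    have h2 : m.exponent j ≤ c j := m.2.le_of_le hmem hle j
    rw [Finsupp.single_eq_same] at h1
    omega
  rw [hfy, hy0, smul_zero]

end Resolution

end TaylorDGA

namespace TaylorDGA

open MvPolynomial

/-! ### Ordered products of anticommuting elements -/

section OrderedProducts

variable {k : Type*} [Field k] {n : ℕ} {I : Ideal (MvPolynomial (Fin n) k)}
variable [LinearOrder (MinGen I)]
variable {A : Type*} [Ring A]

/-- The product of the `f m`, `m ∈ W`, in increasing order of `m`. -/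
def ordProd (f : MinGen I → A) (W : Finset (MinGen I)) : A :=
  ((W.sort (· ≤ ·)).map f).prod

theorem ordProd_empty (f : MinGen I → A) : ordProd f ∅ = 1 := by
  simp [ordProd]

theorem ordProd_insert (f : MinGen I → A) {a : MinGen I} {W : Finset (MinGen I)}
    (h : ∀ x ∈ W, a < x) : ordProd f (insert a W) = f a * ordProd f W := by
  rw [ordProd, Finset.sort_insert _ (fun x hx => (h x hx).le) fun ha => lt_irrefl _ (h a ha)]
  simp [ordProd]

theorem filter_lt_eq_empty {a : MinGen I} {W : Finset (MinGen I)} (h : ∀ x ∈ W, a < x) :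
    W.filter (fun x => x < a) = ∅ :=
  Finset.filter_eq_empty_iff.2 fun x hx => (h x hx).not_gt

theorem ordProd_mem {𝓐 : ℕ × (Fin n → ℤ) → AddSubgroup A} [GradedRing 𝓐] {f : MinGen I → A}
    (hf : ∀ m, f m ∈ 𝓐 (1, fun j => (m.exponent j : ℤ))) (W : Finset (MinGen I)) :
    ordProd f W ∈ 𝓐 (W.card, fun j => ((∑ m ∈ W, m.exponent) j : ℤ)) := by
  induction W using Finset.induction_on_min with
  | empty =>
    rw [ordProd_empty]
    exact one_mem_zero 𝓐
  | insert a W ha ih =>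
    have haW : a ∉ W := fun h => lt_irrefl _ (ha a h)
    rw [ordProd_insert f ha, Finset.sum_insert haW, Finset.card_insert_of_notMem haW]
    convert SetLike.mul_mem_graded (hf a) ih using 2
    ext j
    · simp [add_comm]
    · simp

variable [Algebra (MvPolynomial (Fin n) k) A]

/-- Moving `f m` to its place passes the factors with smaller index, at one sign each; a repeated
factor gives a square. -/
theorem mul_ordProd {f : MinGen I → A} (hanti : ∀ m m', f m * f m' = -(f m' * f m))
    (hsq : ∀ m, f m * f m = 0) (m : MinGen I) (V : Finset (MinGen I)) :
    f m * ordProd f V = if m ∈ V then 0 else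
      ((-1) ^ (V.filter (fun x => x < m)).card : MvPolynomial (Fin n) k) •
        ordProd f (insert m V) := by
  induction V using Finset.induction_on_min with
  | empty => simp [ordProd]
  | insert a V ha ih =>
    have haV : a ∉ V := fun h => lt_irrefl _ (ha a h)
    rcases lt_trichotomy m a with hlt | rfl | hgt
    · have h : ∀ x ∈ insert a V, m < x := by
        intro x hx
        rcases Finset.mem_insert.1 hx with rfl | hx
        · exact hlt
        · exact hlt.trans (ha x hx)
      rw [if_neg fun hm => lt_irrefl _ (h m hm), filter_lt_eq_empty h, ordProd_insert f h]
      simp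
    · rw [if_pos (Finset.mem_insert_self _ _), ordProd_insert f ha, ← mul_assoc, hsq, zero_mul]
    · rw [ordProd_insert f ha, ← mul_assoc, hanti, neg_mul, mul_assoc, ih]
      by_cases hm : m ∈ V
      · rw [if_pos hm, if_pos (Finset.mem_insert_of_mem hm), mul_zero, neg_zero]
      · have h : ∀ x ∈ insert m V, a < x := by
          intro x hx
          rcases Finset.mem_insert.1 hx with rfl | hx
          · exact hgt
          · exact ha x hx
        rw [if_neg hm, if_neg (by simp [hm, hgt.ne']), Finset.filter_insert, if_pos hgt,
          Finset.card_insert_of_notMem (by simp [haV]), Finset.insert_comm, ordProd_insert f h,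
          mul_smul_comm, pow_succ, mul_neg_one, neg_smul]

theorem ordProd_mul {f : MinGen I → A} (hanti : ∀ m m', f m * f m' = -(f m' * f m))
    (hsq : ∀ m, f m * f m = 0) (W V : Finset (MinGen I)) :
    ordProd f W * ordProd f V = if Disjoint W V then
      ((-1) ^ Taylor.sigma W V : MvPolynomial (Fin n) k) • ordProd f (W ∪ V) else 0 := by
  induction W using Finset.induction_on_min with
  | empty => simp [ordProd_empty, Taylor.sigma]
  | insert a W ha ih =>
    have haW : a ∉ W := fun h => lt_irrefl _ (ha a h)
    rw [ordProd_insert f ha, mul_assoc, ih]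
    by_cases hd : Disjoint W V
    · rw [if_pos hd, mul_smul_comm, mul_ordProd (k := k) hanti hsq]
      by_cases haV : a ∈ V
      · rw [if_pos (Finset.mem_union_right _ haV), smul_zero, if_neg]
        simp [haV]
      · rw [if_neg (by simp [haW, haV]), if_pos (by simp [haV, hd]), Finset.filter_union,
          filter_lt_eq_empty ha, Finset.empty_union, smul_smul, Finset.insert_union]
        rw [show (insert a W : Finset (MinGen I)) = W ∪ {a} by simp,
          Taylor.sigma_union_left V (by simpa using haW), pow_add]
        congr 3
        rw [Taylor.sigma, Finset.singleton_product, Finset.filter_map, Finset.card_map]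
        rfl
    · rw [if_neg hd, mul_zero, if_neg]
      simp [hd]

theorem d_ordProd {d : A →ₗ[MvPolynomial (Fin n) k] A} {f : MinGen I → A}
    (hd1 : d 1 = 0) (hd : ∀ m x, d (f m * x) = monomial m.exponent (1 : k) • x - f m * d x)
    (W : Finset (MinGen I)) :
    d (ordProd f W) = ∑ m ∈ W, ((-1) ^ (W.filter (fun m' => m' < m)).card *
      monomial m.exponent 1 : MvPolynomial (Fin n) k) • ordProd f (W.erase m) := by
  induction W using Finset.induction_on_min with
  | empty => simp [ordProd_empty, hd1]
  | insert a W ha ih =>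
    have haW : a ∉ W := fun h => lt_irrefl _ (ha a h)
    rw [ordProd_insert f ha, hd, ih, Finset.sum_insert haW, Finset.filter_insert,
      if_neg (lt_irrefl a), filter_lt_eq_empty ha, Finset.card_empty, pow_zero, one_mul,
      Finset.erase_insert haW, sub_eq_add_neg, Finset.mul_sum, ← Finset.sum_neg_distrib]
    congr 1
    refine Finset.sum_congr rfl fun m hm => ?_
    rw [Finset.filter_insert, if_pos (ha m hm), Finset.card_insert_of_notMem (by simp [haW]),
      Finset.erase_insert_of_ne (ha m hm).ne,
      ordProd_insert f fun x hx => ha x (Finset.mem_of_mem_erase hx), mul_smul_comm, pow_succ,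
      mul_neg_one, neg_mul, neg_smul]

end OrderedProducts

/-! ### The morphism from the Taylor resolution -/

section TaylorHom

variable {k : Type*} [Field k] {n : ℕ} {I : Ideal (MvPolynomial (Fin n) k)}

theorem le_lcmExp {W : Finset (MinGen I)} {m : MinGen I} (hm : m ∈ W) :
    m.exponent ≤ lcmExp W :=
  Finset.le_sup (f := MinGen.exponent) hm

theorem lcmExp_mono {W V : Finset (MinGen I)} (h : W ⊆ V) : lcmExp W ≤ lcmExp V :=
  Finset.sup_mono h

theorem lcmExp_le_sum (W : Finset (MinGen I)) : lcmExp W ≤ ∑ m ∈ W, m.exponent :=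
  Finset.sup_le fun _ hm => Finset.single_le_sum (fun _ _ => zero_le) hm

variable [LinearOrder (MinGen I)]
variable {A : Type*} [Ring A] [Algebra (MvPolynomial (Fin n) k) A]
variable {𝓐 : ℕ × (Fin n → ℤ) → AddSubgroup A} [GradedRing 𝓐]
variable {d : A →ₗ[MvPolynomial (Fin n) k] A}
variable {ι : Type*} {b : Module.Basis ι (MvPolynomial (Fin n) k) A} {deg : ι → ℕ × (Fin n → ℤ)}

/-- Wherever the sum of exponents exceeds the lcm, some `m ∈ W` has a nonzero exponent, so the lcm
is at least `1` there and division applies. -/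
theorem exists_divided_ordProd (h : IsMinimalFreeResolution I 𝓐 d)
    (hD : IsMultigradedDGA 𝓐 d) (hI : IsSquarefreeMonomialIdeal I) (hb : ∀ e, b e ∈ 𝓐 (deg e))
    {f : MinGen I → A} (hf : ∀ m, f m ∈ 𝓐 (1, fun j => (m.exponent j : ℤ)))
    (W : Finset (MinGen I)) : ∃ y ∈ 𝓐 (W.card, fun j => (lcmExp W j : ℤ)),
      ordProd f W = monomial (∑ m ∈ W, m.exponent - lcmExp W) (1 : k) • y := by
  refine hD.exists_eq_monomial_smul hb (h.deg_squarefree hD hI hb _) (ordProd_mem hf W) _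
    (fun j => ?_) fun j hj => ?_
  · have := lcmExp_le_sum W j
    rw [Finsupp.tsub_apply]
    omega
  · by_contra! h0
    refine hj ?_
    rw [Finsupp.tsub_apply, Finsupp.finsetSum_apply, Finset.sum_eq_zero, zero_tsub]
    intro m hm
    have := le_lcmExp hm j
    omega

/-- A DGA structure on the minimal free resolution admits a morphism from the Taylor resolution,
which maps `g_W` to the product of the `f m`, `m ∈ W`, divided by `∏ m / m_W`. -/
theorem exists_taylor_hom (h : IsMinimalFreeResolution I 𝓐 d)
    (hD : IsMultigradedDGA 𝓐 d) (hI : IsSquarefreeMonomialIdeal I) (hb : ∀ e, b e ∈ 𝓐 (deg e))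
    {f : MinGen I → A} (hf : ∀ m, f m ∈ 𝓐 (1, fun j => (m.exponent j : ℤ)))
    (hdf : ∀ m, d (f m) = monomial m.exponent (1 : k) • (1 : A)) :
    ∃ φ : Taylor I →ₐ[MvPolynomial (Fin n) k] A, (∀ m, φ (Taylor.g I {m}) = f m) ∧
      (∀ W, φ (Taylor.g I W) ∈ 𝓐 (W.card, fun j => (lcmExp W j : ℤ))) ∧
      ∀ t, φ (Taylor.d I t) = d (φ t) := by
  have hanti : ∀ m m', f m * f m' = -(f m' * f m) := fun m m' => by
    rw [hD.graded_comm _ _ _ _ _ _ (hf m) (hf m')]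
    simp
  have hsq := fun m => h.mul_self_eq_zero hD hI hb m (hf m)
  have hd1 : d 1 = 0 := hD.d_zero _ _ (one_mem_zero 𝓐)
  have hd : ∀ m x, d (f m * x) = monomial m.exponent (1 : k) • x - f m * d x := fun m x => by
    rw [hD.leibniz _ _ _ _ (hf m), hdf, smul_mul_assoc, one_mul, pow_one, neg_one_mul,
      sub_eq_add_neg]
  choose y hy hfy using exists_divided_ordProd h hD hI hb hf
  -- Both formulas for `y` are checked after multiplication by the monomials that were divided out;
  -- what remains is an identity of exponents.
  have hy_mul : ∀ W V, y W * y V = (Taylor.mulCoeff W V : MvPolynomial (Fin n) k) • y (W ∪ V) := by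
    intro W V
    refine monomial_smul_cancel b
      ((∑ m ∈ W, m.exponent - lcmExp W) + (∑ m ∈ V, m.exponent - lcmExp V)) ?_
    rw [← one_mul (1 : k), ← monomial_mul, ← smul_mul_smul_comm, ← hfy, ← hfy,
      ordProd_mul (k := k) hanti hsq, Taylor.mulCoeff]
    split_ifs with hdis
    · rw [hfy, smul_smul, smul_smul, monomial_mul, mul_left_comm, monomial_mul, mul_one, mul_one]
      congr 4
      rw [Finset.sum_union hdis]
      refine Finsupp.ext fun j => ?_
      have h1 := lcmExp_le_sum W j
      have h2 := lcmExp_le_sum V j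
      simp only [Taylor.lcmExp_union, Finsupp.add_apply, Finsupp.tsub_apply, Finsupp.sup_apply]
      omega
    · rw [zero_smul, smul_zero]
  have hy_d : ∀ W, d (y W) = ∑ m ∈ W, ((-1) ^ (W.filter (fun m' => m' < m)).card *
      monomial (lcmExp W - lcmExp (W.erase m)) 1 : MvPolynomial (Fin n) k) • y (W.erase m) := by
    intro W
    refine monomial_smul_cancel b (∑ m ∈ W, m.exponent - lcmExp W) ?_
    rw [← map_smul, ← hfy, d_ordProd hd1 hd, Finset.smul_sum]
    refine Finset.sum_congr rfl fun m hm => ?_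
    rw [hfy, smul_smul, smul_smul, mul_assoc, mul_left_comm (monomial _ _), monomial_mul,
      monomial_mul]
    congr 4
    rw [← Finset.add_sum_erase W _ hm]
    refine Finsupp.ext fun j => ?_
    have h1 := lcmExp_le_sum (W.erase m) j
    have h2 := lcmExp_mono (Finset.erase_subset m W) j
    have h3 := lcmExp_le_sum W j
    rw [← Finset.add_sum_erase W _ hm] at h3
    simp only [Finsupp.add_apply, Finsupp.tsub_apply] at h3 ⊢
    omega
  let ψ : Taylor I →ₗ[MvPolynomial (Fin n) k] A := (Taylor.g I).constr ℕ y
  have hψ : ∀ W, ψ (Taylor.g I W) = y W := (Taylor.g I).constr_basis ℕ y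
  have hy0 : y ∅ = 1 := by
    have := hfy ∅
    rw [ordProd_empty, Finset.sum_empty, zero_tsub] at this
    rw [this]
    exact (one_smul _ _).symm
  refine ⟨AlgHom.ofLinearMap ψ (by rw [Taylor.one_def, hψ, hy0]) fun s t => ?_,
    fun m => ?_, fun W => ?_, fun t => ?_⟩
  · induction s using Taylor.induction_g with
    | hg W =>
      induction t using Taylor.induction_g with
      | hg V => rw [Taylor.g_mul_g, map_smul, hψ, hψ, hψ, hy_mul]
      | h0 => simp
      | hadd x y hx hy => rw [mul_add, map_add, map_add, mul_add, hx, hy]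
      | hsmul c x hx => rw [mul_smul_comm, map_smul, map_smul, mul_smul_comm, hx]
    | h0 => simp
    | hadd x y hx hy => rw [add_mul, map_add, map_add, add_mul, hx, hy]
    | hsmul c x hx => rw [smul_mul_assoc, map_smul, map_smul, smul_mul_assoc, hx]
  · rw [AlgHom.ofLinearMap_apply, hψ]
    have hm := hfy {m}
    have hl : lcmExp {m} = m.exponent := Finset.sup_singleton
    rw [hl, Finset.sum_singleton, tsub_self] at hm
    rw [← one_smul (MvPolynomial (Fin n) k) (y {m})]
    refine hm.symm.trans ?_
    simp [ordProd]
  · rw [AlgHom.ofLinearMap_apply, hψ]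
    exact hy W
  · rw [AlgHom.ofLinearMap_apply, AlgHom.ofLinearMap_apply]
    induction t using Taylor.induction_g with
    | hg W => simp only [Taylor.d_g, map_sum, map_smul, hψ, hy_d]
    | h0 => simp
    | hadd x y hx hy => simp only [map_add, hx, hy]
    | hsmul c x hx => simp only [map_smul, hx]

end TaylorHom

end TaylorDGA

namespace TaylorDGA

open MvPolynomial

/-! ### Homogeneous components of the Taylor resolution and surjectivity -/

section TaylorGrading

variable {k : Type*} [Field k] {n : ℕ} {I : Ideal (MvPolynomial (Fin n) k)}
variable [LinearOrder (MinGen I)]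

theorem Taylor.monomial_smul_g_mem {W : Finset (MinGen I)} {a : Fin n → ℤ} (c : Fin n →₀ ℕ) (r : k)
    (ha : ∀ j, a j = c j + lcmExp W j) :
    monomial c r • Taylor.g I W ∈ Taylor.grading I (W.card, a) := by
  classical
  intro V
  rw [map_smul, Module.Basis.repr_self, Finsupp.smul_apply, Finsupp.single_apply]
  split_ifs with h
  · subst h
    refine ⟨fun _ => rfl, ?_⟩
    rw [smul_eq_mul, mul_one]
    convert monomial_mem_polyGrading c r using 2
    funext j
    linarith [ha j]
  · rw [smul_zero]
    exact ⟨fun h => absurd rfl h, zero_mem _⟩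

theorem Taylor.mem_closure_of_mem_grading {i : ℕ} {a : Fin n → ℤ} {t : Taylor I}
    (ht : t ∈ Taylor.grading I (i, a)) :
    t ∈ AddSubgroup.closure {s | ∃ (W : Finset (MinGen I)) (c : Fin n →₀ ℕ) (r : k), W.card = i ∧
      (∀ j, a j = c j + lcmExp W j) ∧ s = monomial c r • Taylor.g I W} := by
  rw [← (Taylor.g I).linearCombination_repr t, Finsupp.linearCombination_apply, Finsupp.sum]
  refine sum_mem fun W hW => ?_
  obtain ⟨h1, h2⟩ := ht W
  obtain h0 | ⟨c, hc, h⟩ := eq_zero_or_monomial_of_mem_polyGrading h2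
  · rw [h0, zero_smul]
    exact zero_mem _
  · refine AddSubgroup.subset_closure ⟨W, c, _, h1 (Finsupp.mem_support_iff.1 hW), fun j => ?_,
      congrArg (· • Taylor.g I W) h⟩
    rw [hc]
    ring

/-- Only existence of a decomposition is needed: after applying a degree-preserving `φ`, the
components are identified by the projections of the target. -/
theorem Taylor.exists_homogeneous_sum (t : Taylor I) :
    ∃ D : (ℕ × (Fin n → ℤ)) →₀ Taylor I, (∀ p, D p ∈ Taylor.grading I p) ∧
      D.sum (fun _ s => s) = t := by
  classical
  let H : AddSubmonoid (Taylor I) :=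
    { carrier := {t | ∃ D : (ℕ × (Fin n → ℤ)) →₀ Taylor I, (∀ p, D p ∈ Taylor.grading I p) ∧
        D.sum (fun _ s => s) = t}
      zero_mem' := ⟨0, fun _ => zero_mem _, Finsupp.sum_zero_index⟩
      add_mem' := by
        rintro _ _ ⟨D, hD, rfl⟩ ⟨E, hE, rfl⟩
        exact ⟨D + E, fun p => add_mem (hD p) (hE p),
          Finsupp.sum_add_index' (fun _ => rfl) fun _ _ _ => rfl⟩ }
  change t ∈ H
  rw [← (Taylor.g I).linearCombination_repr t, Finsupp.linearCombination_apply, Finsupp.sum]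
  refine sum_mem fun W _ => ?_
  induction (Taylor.g I).repr t W using MvPolynomial.induction_on' with
  | monomial c r =>
    refine ⟨Finsupp.single (W.card, fun j => (c j : ℤ) + lcmExp W j)
      (monomial c r • Taylor.g I W), fun p => ?_, Finsupp.sum_single_index rfl⟩
    rw [Finsupp.single_apply]
    split_ifs with h
    · rw [← h]
      exact Taylor.monomial_smul_g_mem c r fun _ => rfl
    · exact zero_mem _
  | add p q hp hq =>
    rw [add_smul]
    exact add_mem hp hq

/-- For a term `x^c g_W` of multidegree `a`, both `m` and `m_W` divide `x^a`. The new coefficient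
is, up to sign and scalar, `m x^a / lcm(m, m_W)`, a multiple of `m`. -/
theorem Taylor.exists_g_singleton_mul_eq {m : MinGen I} {i : ℕ} {a : Fin n → ℤ}
    (hm : ∀ j, (m.exponent j : ℤ) ≤ a j) {t : Taylor I} (ht : t ∈ Taylor.grading I (i, a)) :
    ∃ s, Taylor.g I {m} * t = monomial m.exponent (1 : k) • s := by
  have hcl := Taylor.mem_closure_of_mem_grading ht
  clear ht
  induction hcl using AddSubgroup.closure_induction with
  | mem t ht =>
    obtain ⟨W, c, r, -, ha, rfl⟩ := ht
    rw [mul_smul_comm, Taylor.g_mul_g, Taylor.mulCoeff]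
    split_ifs with h
    · refine ⟨((-1) ^ Taylor.sigma {m} W *
        monomial (c + lcmExp W - lcmExp ({m} ∪ W)) r : MvPolynomial (Fin n) k) •
          Taylor.g I ({m} ∪ W), ?_⟩
      rw [smul_smul, smul_smul, mul_left_comm, mul_left_comm (monomial _ _), monomial_mul,
        monomial_mul, mul_one, one_mul]
      congr 4
      refine Finsupp.ext fun j => ?_
      have h1 := hm j
      have h2 := ha j
      have h3 : lcmExp {m} = m.exponent := Finset.sup_singleton
      simp only [Taylor.lcmExp_union, h3, Finsupp.add_apply, Finsupp.tsub_apply,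
        Finsupp.sup_apply]
      omega
    · exact ⟨0, by rw [zero_smul, smul_zero, smul_zero]⟩
  | zero => exact ⟨0, by rw [mul_zero, smul_zero]⟩
  | add x y _ _ hx hy =>
    obtain ⟨x', hx'⟩ := hx
    obtain ⟨y', hy'⟩ := hy
    exact ⟨x' + y', by rw [mul_add, hx', hy', smul_add]⟩
  | neg x _ hx =>
    obtain ⟨x', hx'⟩ := hx
    exact ⟨-x', by rw [mul_neg, hx', smul_neg]⟩

variable {A : Type*} [Ring A] [Algebra (MvPolynomial (Fin n) k) A]
variable {𝓐 : ℕ × (Fin n → ℤ) → AddSubgroup A} [GradedRing 𝓐]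
variable {d : A →ₗ[MvPolynomial (Fin n) k] A}
variable {ι : Type*} {b : Module.Basis ι (MvPolynomial (Fin n) k) A} {deg : ι → ℕ × (Fin n → ℤ)}
variable {φ : Taylor I →ₐ[MvPolynomial (Fin n) k] A}

theorem IsMultigradedDGA.map_mem_of_mem_grading (hD : IsMultigradedDGA 𝓐 d)
    (hφ : ∀ W, φ (Taylor.g I W) ∈ 𝓐 (W.card, fun j => (lcmExp W j : ℤ)))
    {p : ℕ × (Fin n → ℤ)} {t : Taylor I} (ht : t ∈ Taylor.grading I p) : φ t ∈ 𝓐 p := by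
  obtain ⟨i, a⟩ := p
  have hcl := Taylor.mem_closure_of_mem_grading ht
  clear ht
  induction hcl using AddSubgroup.closure_induction with
  | mem t ht =>
    obtain ⟨W, c, r, rfl, ha, rfl⟩ := ht
    rw [map_smul]
    exact hD.smul_mem c r (hφ W) ha
  | zero =>
    rw [map_zero]
    exact zero_mem _
  | add x y _ _ hx hy =>
    rw [map_add]
    exact add_mem hx hy
  | neg x _ hx =>
    rw [map_neg]
    exact neg_mem hx

theorem map_eq_proj_map_sum (hφ : ∀ {p t}, t ∈ Taylor.grading I p → φ t ∈ 𝓐 p)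
    {D : (ℕ × (Fin n → ℤ)) →₀ Taylor I} (hD : ∀ p, D p ∈ Taylor.grading I p)
    (p : ℕ × (Fin n → ℤ)) : φ (D p) = GradedRing.proj 𝓐 p (φ (D.sum fun _ s => s)) := by
  rw [Finsupp.sum, map_sum, map_sum, Finset.sum_eq_single p, proj_of_mem (hφ (hD p))]
  · intro q _ hq
    exact proj_of_mem_ne (hφ (hD q)) hq
  · intro hp
    rw [Finsupp.notMem_support_iff.1 hp, map_zero, map_zero]

theorem exists_mem_grading_of_mem_range (hφ : ∀ {p t}, t ∈ Taylor.grading I p → φ t ∈ 𝓐 p)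
    {p : ℕ × (Fin n → ℤ)} {x : A} (hx : x ∈ 𝓐 p) (hr : x ∈ φ.range) :
    ∃ t ∈ Taylor.grading I p, φ t = x := by
  obtain ⟨t, ht⟩ := hr
  obtain ⟨D, hD, rfl⟩ := Taylor.exists_homogeneous_sum t
  refine ⟨D p, hD p, ?_⟩
  rw [map_eq_proj_map_sum hφ hD]
  exact (congrArg _ ht).trans (proj_of_mem hx)

theorem IsMultigradedDGA.mem_range_of_basis_mem (hD : IsMultigradedDGA 𝓐 d)
    (hb : ∀ e, b e ∈ 𝓐 (deg e)) {i : ℕ} {a : Fin n → ℤ}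
    (he : ∀ e, (deg e).1 = i → (∀ j, (deg e).2 j ≤ a j) → b e ∈ φ.range) {x : A}
    (hx : x ∈ 𝓐 (i, a)) : x ∈ φ.range := by
  have hcl := hD.mem_closure_basis b hb hx
  clear hx
  induction hcl using AddSubgroup.closure_induction with
  | mem x hx =>
    obtain ⟨e, c, r, hi, ha, rfl⟩ := hx
    refine φ.range.smul_mem (he e hi fun j => ?_) _
    rw [ha]
    omega
  | zero => exact zero_mem _
  | add x y _ _ hx hy => exact add_mem hx hy
  | neg x _ hx => exact neg_mem hx

/-- The inductive step for surjectivity: multiplication by `f m / m` is a contracting homotopy in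
the multidegrees divisible by `m`, so a basis element `e` is `f m * d e / m` up to a boundary, and
boundaries lie in `𝔪 A`. -/
theorem basis_mem_range (h : IsMinimalFreeResolution I 𝓐 d)
    (hD : IsMultigradedDGA 𝓐 d) (hI : IsSquarefreeMonomialIdeal I) (hb : ∀ e, b e ∈ 𝓐 (deg e))
    {f : MinGen I → A} (hf : ∀ m, f m ∈ 𝓐 (1, fun j => (m.exponent j : ℤ)))
    (hdf : ∀ m, d (f m) = monomial m.exponent (1 : k) • (1 : A))
    (hφf : ∀ m, φ (Taylor.g I {m}) = f m)
    (hφ : ∀ {p t}, t ∈ Taylor.grading I p → φ t ∈ 𝓐 p)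
    {i : ℕ} (hi : ∀ {a : Fin n → ℤ} {x : A}, x ∈ 𝓐 (i, a) → x ∈ φ.range) (N : ℕ) :
    ∀ e, (deg e).1 = i + 1 → ∑ j, (deg e).2 j < N → b e ∈ φ.range := by
  -- Induction on a strict bound for the total degree; the bound `0` is vacuous, as multidegrees are
  -- nonnegative.
  induction N with
  | zero =>
    intro e he hN
    have : 0 ≤ ∑ j, (deg e).2 j :=
      Finset.sum_nonneg fun j _ => (h.deg_squarefree hD hI hb _ e he j).1
    omega
  | succ N ih =>
    intro e he hN
    have hbe : b e ∈ 𝓐 (i + 1, (deg e).2) := by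
      rw [← he]
      exact hb e
    have hdeg := h.deg_squarefree hD hI hb _ e he
    generalize (deg e).2 = a at *
    let c : Fin n →₀ ℕ := Finsupp.equivFunOnFinite.symm fun j => (a j).toNat
    have hc : ∀ j, (c j : ℤ) = a j := fun j => Int.toNat_of_nonneg (hdeg j).1
    by_cases hcI : monomial c (1 : k) ∈ I
    · obtain ⟨m, hm⟩ := exists_minGen_le hcI
      have hma : ∀ j, (m.exponent j : ℤ) ≤ a j := fun j => by
        have := hm j
        have := hc j
        omega
      have hfe : f m * b e ∈ 𝓐 (1 + (i + 1), fun j => m.exponent j + a j) :=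
        SetLike.mul_mem_graded (hf m) hbe
      obtain ⟨y, hy, hfy⟩ := hD.exists_eq_monomial_smul hb (h.deg_squarefree hD hI hb _) hfe
        (a' := a) m.exponent (fun _ => rfl) fun j hj => by
          have := hma j
          omega
      rw [add_comm] at hy
      -- A homogeneous lift of `d (b e)` is required, since divisibility of `g_m * t` by `m` uses
      -- the multidegree of `t`.
      obtain ⟨t, ht, hte⟩ := exists_mem_grading_of_mem_range hφ (hD.d_mem _ _ _ hbe)
        (hi (hD.d_mem _ _ _ hbe))
      obtain ⟨s, hs⟩ := Taylor.exists_g_singleton_mul_eq hma ht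
      -- The Leibniz rule for `f m * b e = m y` reads `m d y = m b e - f m * d (b e)`, and `f m * d
      -- (b e) = m φ s`; then `m` is cancelled.
      have key : b e = d y + φ s := by
        refine monomial_smul_cancel b m.exponent ?_
        rw [smul_add, ← map_smul d, ← map_smul φ, ← hfy, ← hs, map_mul φ, hφf, hte,
          hD.leibniz _ _ _ _ (hf m), hdf, smul_mul_assoc, one_mul, pow_one, neg_one_mul,
          neg_add_cancel_right]
      rw [key]
      refine add_mem ?_ ⟨s, rfl⟩
      -- By minimality `d y` is a sum of terms `x_j z`, and the basis elements occurring in `z` have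
      -- total degree at least one less than `b e`.
      have hcl := hD.mem_closure_X_smul (hD.d_mem _ _ _ hy) (h.minimal y)
      refine (AddSubgroup.closure_le φ.range.toSubring.toAddSubgroup).2 ?_ hcl
      rintro _ ⟨j, z, hz, rfl⟩
      refine φ.range.smul_mem (hD.mem_range_of_basis_mem hb (fun e' he' hle => ih e' he' ?_) hz) _
      have h1 : ∑ l, (deg e').2 l ≤ ∑ l, (a l - (Finsupp.single j 1 : Fin n →₀ ℕ) l) :=
        Finset.sum_le_sum fun l _ => hle l
      have h2 : ∑ l, ((Finsupp.single j 1 : Fin n →₀ ℕ) l : ℤ) = 1 := by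
        simp [Finsupp.single_apply]
      rw [Finset.sum_sub_distrib, h2] at h1
      push_cast at hN
      omega
    · rw [h.eq_zero_of_notMem hD hb i (fun c' hc' => ?_) hbe]
      · exact zero_mem _
      · rwa [show c' = c from Finsupp.ext fun j => by
          have := hc j
          have := hc' j
          omega]

theorem taylor_hom_surjective (h : IsMinimalFreeResolution I 𝓐 d)
    (hD : IsMultigradedDGA 𝓐 d) (hI : IsSquarefreeMonomialIdeal I) (hb : ∀ e, b e ∈ 𝓐 (deg e))
    {f : MinGen I → A} (hf : ∀ m, f m ∈ 𝓐 (1, fun j => (m.exponent j : ℤ)))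
    (hdf : ∀ m, d (f m) = monomial m.exponent (1 : k) • (1 : A))
    (hφf : ∀ m, φ (Taylor.g I {m}) = f m)
    (hφ : ∀ {p t}, t ∈ Taylor.grading I p → φ t ∈ 𝓐 p) : Function.Surjective φ := by
  have hhom : ∀ (i : ℕ) {a : Fin n → ℤ} {x : A}, x ∈ 𝓐 (i, a) → x ∈ φ.range := by
    intro i
    induction i with
    | zero =>
      intro a x hx
      obtain ⟨p, -, rfl⟩ := h.exists_eq_smul_one hD hb hx
      exact φ.range.smul_mem (one_mem _) _
    | succ i ih =>
      intro a x hx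
      refine hD.mem_range_of_basis_mem hb (fun e he _ => ?_) hx
      refine basis_mem_range h hD hI hb hf hdf hφf hφ ih ((∑ j, (deg e).2 j).toNat + 1) e he ?_
      omega
  intro x
  change x ∈ φ.range
  induction x using DirectSum.Decomposition.inductionOn 𝓐 with
  | zero => exact zero_mem _
  | homogeneous x => exact hhom _ x.2
  | add x y hx hy => exact add_mem hx hy

end TaylorGrading

end TaylorDGA

/-! ### The quotient by the kernel -/

theorem theorem3p6 {k : Type*} [Field k] {n : ℕ}
    (I : Ideal (MvPolynomial (Fin n) k)) (hI : TaylorDGA.IsSquarefreeMonomialIdeal I)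
    [LinearOrder (TaylorDGA.MinGen I)]
    {F : Type*} [Ring F] [Algebra (MvPolynomial (Fin n) k) F]
    (𝓕 : ℕ × (Fin n → ℤ) → AddSubgroup F) [GradedRing 𝓕]
    (d : F →ₗ[MvPolynomial (Fin n) k] F)
    (hDGA : TaylorDGA.IsMultigradedDGA 𝓕 d)
    (hres : TaylorDGA.IsMinimalFreeResolution I 𝓕 d) :
    ∃ J : TaylorDGA.DGIdeal (TaylorDGA.Taylor.grading I) (TaylorDGA.Taylor.d I),
      Nonempty (TaylorDGA.DGAIso 𝓕 d J.quotGrading J.quotD) := by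
  obtain ⟨X, b, deg, hb⟩ := hres.exists_basis
  choose f hf hdf using fun m : TaylorDGA.MinGen I => hres.smul_one_mem_range hDGA m.2.prop
  obtain ⟨φ, hφf, hφg, hφd⟩ := TaylorDGA.exists_taylor_hom hres hDGA hI hb hf hdf
  have hφ : ∀ {p t}, t ∈ TaylorDGA.Taylor.grading I p → φ t ∈ 𝓕 p :=
    fun ht => hDGA.map_mem_of_mem_grading hφg ht
  have hsurj := TaylorDGA.taylor_hom_surjective hres hDGA hI hb hf hdf hφf hφ
  let J : TaylorDGA.DGIdeal (TaylorDGA.Taylor.grading I) (TaylorDGA.Taylor.d I) :=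
    { ideal := RingHom.ker φ
      isTwoSided := inferInstance
      homogeneous := by
        intro t ht
        obtain ⟨D, hD, rfl⟩ := TaylorDGA.Taylor.exists_homogeneous_sum t
        -- The images of the components `D p` are the projections of `φ t = 0`, so each component
        -- lies in the kernel.
        refine sum_mem fun p _ => Ideal.subset_span ⟨?_, p, hD p⟩
        rw [RingHom.mem_ker] at ht ⊢
        rw [TaylorDGA.map_eq_proj_map_sum hφ hD, ht, map_zero]
      d_mem := by
        intro t ht
        rw [RingHom.mem_ker] at ht ⊢
        rw [hφd, ht, map_zero] }
  let E : J.Quot ≃ₐ[MvPolynomial (Fin n) k] F := Ideal.quotientKerAlgEquivOfSurjective hsurj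
  have hE : ∀ t, E.symm (φ t) = Ideal.Quotient.mk J.ideal t :=
    fun t => Ideal.quotientKerAlgEquivOfSurjective_symm_apply hsurj t
  refine ⟨J, ⟨⟨E.symm, fun p x => ⟨?_, fun hx => ?_⟩, fun x => ?_⟩⟩⟩
  · rintro ⟨t, ht, htx⟩
    have : φ t = x := E.symm.injective ((hE t).trans htx)
    rw [← this]
    exact hφ ht
  · obtain ⟨t, ht, rfl⟩ := TaylorDGA.exists_mem_grading_of_mem_range hφ hx (hsurj x)
    exact ⟨t, ht, (hE t).symm⟩
  · obtain ⟨t, rfl⟩ := hsurj x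
    rw [← hφd, hE, hE, J.quotD_mk]
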